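/- Let $G$ be a nondiscrete locally compact second countable Hausdorff group with a fixed (left) Haar measure $\lambda$. Let $\mathbb M=\mathbb M(G)$ be the space of closed discrete subsets of $G$ with the $\sigma$-algebra generated by the counting functions $N_U(\omega)=|\omega\cap U|$, $U\subseteq G$ Borel, on which $G$ acts by left translation. For a standard Borel space $\Xi$, let $\Xi^{\mathbb M}$ be the space of subsets $\omega\subseteq G\times\Xi$ whose projection to $G$ is closed and discrete and in which each point of $G$ carries at most one mark, with the $\sigma$-algebra generated by $\omega\mapsto|\omega\cap U|$, $U\subseteq G\times\Xi$ Borel, and the action $g\omega=\{(gx,\xi):(x,\xi)\in\omega\}$. A point process (respectively, a $\Xi$-marked point process) is a $G$-invariant probability measure on $\mathbb M$ (respectively, on $\Xi^{\mathbb M}$); the intensity of a point process $\nu$ is the value, independent of the Borel set $U$ with $0<\lambda(U)<\infty$, of $\lambda(U)^{-1}\,\mathbb E_\nu[N_U]$. An action on a probability space is free if almost every point has trivial stabiliser. Two actions $G\curvearrowright(X,\mu)$ and $G\curvearrowright(Y,\nu)$ are abstractly isomorphic if there is a measure-preserving $G$-equivariant Borel isomorphism between $G$-invariant measurable subsets of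 full measure of $X$ and $Y$. Then: 1. Every free probability-measure-preserving (jointly measurable) action of $G$ on a standard Borel probability space $(X,\mu)$ is abstractly isomorphic to the action $G\curvearrowright(\mathbb M,\nu)$ of a point process $\nu$ of finite intensity. 2. For every standard Borel space $\Xi$ and every $\Xi$-marked point process $\mu$ on $G$ whose action $G\curvearrowright(\Xi^{\mathbb M},\mu)$ is free, there is an (unmarked) point process $\nu$ on $G$ such that $G\curvearrowright(\Xi^{\mathbb M},\mu)$ and $G\curvearrowright(\mathbb M,\nu)$ are abstractly isomorphic. -/

import Mathlib

open MeasureTheory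
open scoped ENNReal

noncomputable section

/-- The configuration space of `G`: the closed and discrete subsets of `G`. In a locally compact
Hausdorff space these are the sets that meet every compact set in a finite set. -/
def Config (G : Type*) [TopologicalSpace G] : Type _ :=
  {ω : Set G // ∀ K : Set G, IsCompact K → (ω ∩ K).Finite}

/-- The `Ξ`-marked configuration space of `G`: sets of pairs `(g, ξ)` whose set of points `g` is
a closed and discrete subset of `G`, each point carrying exactly one mark. -/
def MarkedConfig (G Ξ : Type*) [TopologicalSpace G] : Type _ :=
  {ω : Set (G × Ξ) //
    (∀ K : Set G, IsCompact K → (Prod.fst '' ω ∩ K).Finite) ∧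
    ∀ (g : G) (ξ ξ' : Ξ), (g, ξ) ∈ ω → (g, ξ') ∈ ω → ξ = ξ'}

namespace Config

variable {G : Type*} [TopologicalSpace G]

/-- The point counting function `N_U(ω) = |ω ∩ U|`. -/
def count (U : Set G) (ω : Config G) : ℕ∞ := (ω.1 ∩ U).encard

/-- The σ-algebra generated by the point counting functions of the Borel sets. -/
instance [MeasurableSpace G] : MeasurableSpace (Config G) :=
  ⨆ (U : Set G) (_ : MeasurableSet U), MeasurableSpace.comap (count U) ⊤

/-- The shift action `g • ω = {g x | x ∈ ω}`. -/
instance [Group G] [IsTopologicalGroup G] : MulAction G (Config G) where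
  smul g ω := ⟨(fun x => g * x) '' ω.1, fun K hK => by
    refine ((ω.2 ((fun x => g⁻¹ * x) '' K)
      (hK.image (continuous_const_mul g⁻¹))).image (fun x => g * x)).subset ?_
    rintro _ ⟨⟨x, hx, rfl⟩, hxK⟩
    exact ⟨x, ⟨hx, g * x, hxK, by simp⟩, rfl⟩⟩
  one_smul ω := Subtype.ext (by
    change (fun x => (1 : G) * x) '' ω.1 = ω.1
    simp)
  mul_smul g h ω := Subtype.ext (by
    change (fun x => (g * h) * x) '' ω.1 = (fun x => g * x) '' ((fun x => h * x) '' ω.1)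
    rw [Set.image_image]
    simp only [mul_assoc])

end Config

namespace MarkedConfig

variable {G Ξ : Type*} [TopologicalSpace G]

/-- The point counting function `N_U(ω) = |ω ∩ U|` for `U ⊆ G × Ξ`. -/
def count (U : Set (G × Ξ)) (ω : MarkedConfig G Ξ) : ℕ∞ := (ω.1 ∩ U).encard

/-- The σ-algebra generated by the point counting functions of the Borel sets of `G × Ξ`. -/
instance [MeasurableSpace G] [MeasurableSpace Ξ] : MeasurableSpace (MarkedConfig G Ξ) :=
  ⨆ (U : Set (G × Ξ)) (_ : MeasurableSet U), MeasurableSpace.comap (count U) ⊤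

/-- The shift action `g • ω = {(g x, ξ) | (x, ξ) ∈ ω}`. -/
instance [Group G] [IsTopologicalGroup G] : MulAction G (MarkedConfig G Ξ) where
  smul g ω := ⟨(fun p => (g * p.1, p.2)) '' ω.1, fun K hK => by
      refine ((ω.2.1 ((fun x => g⁻¹ * x) '' K)
        (hK.image (continuous_const_mul g⁻¹))).image (fun x => g * x)).subset ?_
      rintro _ ⟨⟨_, ⟨p, hp, rfl⟩, rfl⟩, hxK⟩
      exact ⟨p.1, ⟨⟨p, hp, rfl⟩, g * p.1, hxK, by simp⟩, rfl⟩,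
    by
      rintro _ ξ ξ' ⟨⟨a, b⟩, hp, h⟩ ⟨⟨a', b'⟩, hp', h'⟩
      simp only [Prod.mk.injEq] at h h'
      obtain ⟨rfl, rfl⟩ := h
      obtain ⟨h1, rfl⟩ := h'
      obtain rfl : a' = a := mul_left_cancel h1
      exact ω.2.2 _ _ _ hp hp'⟩
  one_smul ω := Subtype.ext (by
    change (fun p : G × Ξ => ((1 : G) * p.1, p.2)) '' ω.1 = ω.1
    simp)
  mul_smul g h ω := Subtype.ext (by
    change (fun p : G × Ξ => ((g * h) * p.1, p.2)) '' ω.1 =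
      (fun p : G × Ξ => (g * p.1, p.2)) '' ((fun p : G × Ξ => (h * p.1, p.2)) '' ω.1)
    rw [Set.image_image]
    simp only [mul_assoc])

end MarkedConfig

/-- Almost every point has trivial stabiliser. -/
def EssentiallyFree (G : Type*) {X : Type*} [Group G] [MulAction G X] [MeasurableSpace X]
    (μ : Measure X) : Prop :=
  ∀ᵐ x ∂μ, MulAction.stabilizer G x = ⊥

/-- Isomorphism of the actions `G ↷ (X, μ)` and `G ↷ (Y, ν)`: a measure preserving, equivariant
Borel isomorphism between invariant measurable sets of full measure. -/
def AbstractlyIsomorphic (G : Type*) {X Y : Type*} [Group G] [MulAction G X] [MulAction G Y]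
    [MeasurableSpace X] [MeasurableSpace Y] (μ : Measure X) (ν : Measure Y) : Prop :=
  ∃ (X₀ : Set X) (Y₀ : Set Y) (e : X₀ ≃ᵐ Y₀),
    MeasurableSet X₀ ∧ MeasurableSet Y₀ ∧ μ X₀ᶜ = 0 ∧ ν Y₀ᶜ = 0 ∧
    (∀ (g : G), ∀ x ∈ X₀, g • x ∈ X₀) ∧ (∀ (g : G), ∀ y ∈ Y₀, g • y ∈ Y₀) ∧
    (∀ (g : G) (x : X₀) (h : g • (x : X) ∈ X₀), (e ⟨g • (x : X), h⟩ : Y) = g • (e x : Y)) ∧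
    MeasurePreserving e (μ.comap Subtype.val) (ν.comap Subtype.val)

/-- `ν` is the law of an invariant point process on `G`. -/
def IsPointProcess {G : Type*} [TopologicalSpace G] [MeasurableSpace G] [Group G]
    [IsTopologicalGroup G] (ν : Measure (Config G)) : Prop :=
  IsProbabilityMeasure ν ∧ SMulInvariantMeasure G (Config G) ν

/-- `ν` is the law of an invariant `Ξ`-marked point process on `G`. -/
def IsMarkedPointProcess {G Ξ : Type*} [TopologicalSpace G] [MeasurableSpace G] [Group G]
    [IsTopologicalGroup G] [MeasurableSpace Ξ] (ν : Measure (MarkedConfig G Ξ)) : Prop :=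
  IsProbabilityMeasure ν ∧ SMulInvariantMeasure G (MarkedConfig G Ξ) ν

/-- The intensity of `ν` with respect to the Haar measure `haar` is `c`: for every Borel set `U`
of positive finite Haar measure, the expected number of points in `U` divided by the Haar measure
of `U` is `c`. -/
def HasIntensity {G : Type*} [TopologicalSpace G] [MeasurableSpace G]
    (haar : Measure G) (ν : Measure (Config G)) (c : ℝ≥0∞) : Prop :=
  ∀ U : Set G, MeasurableSet U → haar U ≠ 0 → haar U ≠ ∞ →
    (∫⁻ ω, (Config.count U ω : ℝ≥0∞) ∂ν) / haar U = c

end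

open Set Filter Topology
open scoped Pointwise

/-! Everything reduces to an equivariant Borel injection `Φ` of a free Borel `G`-space into `Config
G`. Point counts over a countable base separate configurations, so by Lusin–Souslin such a `Φ` is a
measurable embedding, and the push-forward of `μ` is an isomorphic point process. The points with
trivial stabiliser form an invariant Borel set of full measure, so freeness may be assumed
everywhere.

To build `Φ`, take a Borel set `Z` that meets every orbit and whose return times avoid a large
compact set `S` except for `1` (`exists_lacunary_section`). The visits `{g | g⁻¹ • x ∈ Z}` form a
locally finite set depending equivariantly on `x`. Nondiscreteness gives a compact uncountable `R ⊆
G`, hence a Borel injection `r : X → R`. Each visit `g` is replaced by the cluster `g`, `g s`, `g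
r(g⁻¹ x)`. If `S` is large, clusters do not interfere; if `s` and `R` are generic
(`exists_rigid_pattern`), the base point of a cluster can be recognised. One cluster then yields
both `g` and `r(g⁻¹ x)`, hence `x`. The number of points in a compact set is uniformly bounded, so
the mean measure is locally finite and left invariant, that is, a finite multiple of Haar measure:
this is the finite intensity.

The section `Z` comes from an injection `F` of `X` into a metric space that is continuous along
orbits (`exists_orbit_continuous_injection`). By compactness and freeness, `F` moves each point by a
positive amount under a compact set missing `1`. Gluing countably many sets of small `F`-diameter
gives a set, open along orbits, that meets each orbit in small, well separated clumps; a measurable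
selection then picks one point for each clump.

For marked processes it remains to see that `MarkedConfig G Ξ` is standard Borel with a jointly
measurable action. It is parametrised by sorted lists of the points in the layers of a compact
exhaustion, which form a Borel subset of a standard space. -/

/-- A second countable locally compact Hausdorff group is Polish. -/
theorem polishSpace_of_locallyCompact_group (G : Type*) [Group G] [TopologicalSpace G]
    [IsTopologicalGroup G] [T2Space G] [LocallyCompactSpace G] [SecondCountableTopology G] :
    PolishSpace G := by
  let : UniformSpace G := IsTopologicalGroup.rightUniformSpace G
  have : IsRightUniformGroup G := ⟨rfl⟩
  have : CompleteSpace G := IsRightUniformGroup.completeSpace_of_weaklyLocallyCompactSpace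
  have : (uniformity G).IsCountablyGenerated := by
    rw [uniformity_eq_comap_mul_inv_nhds_one]
    infer_instance
  infer_instance

theorem abs_toReal_measure_sub_le {α : Type*} [MeasurableSpace α] (μ : Measure α) {s t : Set α}
    (hs : μ s ≠ ∞) (ht : μ t ≠ ∞) (hst : μ (symmDiff s t) ≠ ∞) :
    |(μ s).toReal - (μ t).toReal| ≤ (μ (symmDiff s t)).toReal := by
  have h1 : μ s ≤ μ t + μ (symmDiff s t) :=
    (measure_mono fun x hx => by
      by_cases h : x ∈ t
      · exact Or.inl h
      · exact Or.inr (Or.inl ⟨hx, h⟩)).trans (measure_union_le _ _)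
  have h2 : μ t ≤ μ s + μ (symmDiff s t) :=
    (measure_mono fun x hx => by
      by_cases h : x ∈ s
      · exact Or.inl h
      · exact Or.inr (Or.inr ⟨hx, h⟩)).trans (measure_union_le _ _)
  have h1' := ENNReal.toReal_mono (by finiteness) h1
  have h2' := ENNReal.toReal_mono (by finiteness) h2
  rw [ENNReal.toReal_add ht hst] at h1'
  rw [ENNReal.toReal_add hs hst] at h2'
  rw [abs_le]
  constructor <;> linarith

/-! ### Borel injections continuous along orbits. -/

section OrbitContinuous

variable {G : Type*} [Group G] [TopologicalSpace G] [IsTopologicalGroup G]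
  [T2Space G] [LocallyCompactSpace G] [SecondCountableTopology G] [MeasurableSpace G] [BorelSpace G]

/-- Translation is continuous in measure on sets of finite Haar measure, and intersecting with the
fixed `B` only shrinks symmetric differences. -/
theorem continuous_toReal_measure_mul_left_preimage_inter (haar : Measure G) [haar.IsHaarMeasure]
    {V : Set G} (hV : MeasurableSet V) (hVfin : haar V ≠ ∞) (B : Set G) :
    Continuous fun h : G => (haar ((fun g => h * g) ⁻¹' V ∩ B)).toReal := by
  have := polishSpace_of_locallyCompact_group G
  have hfin : ∀ h : G, haar ((fun g => h * g) ⁻¹' V) ≠ ∞ := fun h => by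
    rwa [measure_preimage_mul]
  rw [continuous_iff_continuousAt]
  intro h₀
  let f : G → C(G, G) := fun h => ⟨fun g => h * g, continuous_const_mul h⟩
  have hf : Continuous f := ContinuousMap.continuous_of_continuous_uncurry _ continuous_mul
  have key : Tendsto (fun h => haar (symmDiff (f h ⁻¹' V) (f h₀ ⁻¹' V))) (𝓝 h₀) (𝓝 0) :=
    tendsto_measure_symmDiff_preimage_nhds_zero (μ := haar) (ν := haar) (hf.tendsto h₀)
      (Eventually.of_forall fun h => measurePreserving_mul_left haar h)
      (measurePreserving_mul_left haar h₀) hV.nullMeasurableSet hVfin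
  have key' := (ENNReal.tendsto_toReal ENNReal.zero_ne_top).comp key
  rw [ContinuousAt, tendsto_iff_dist_tendsto_zero]
  refine squeeze_zero (fun _ => dist_nonneg) (fun h => ?_) key'
  have hsd : haar (symmDiff (f h ⁻¹' V) (f h₀ ⁻¹' V)) ≠ ∞ :=
    measure_ne_top_of_subset (symmDiff_subset_union)
      (measure_union_ne_top (hfin h) (hfin h₀))
  have hsub : symmDiff ((fun g => h * g) ⁻¹' V ∩ B) ((fun g => h₀ * g) ⁻¹' V ∩ B) ⊆
      symmDiff (f h ⁻¹' V) (f h₀ ⁻¹' V) := by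
    rintro x (⟨⟨h1, h2⟩, h3⟩ | ⟨⟨h1, h2⟩, h3⟩)
    · exact Or.inl ⟨h1, fun h4 => h3 ⟨h4, h2⟩⟩
    · exact Or.inr ⟨h1, fun h4 => h3 ⟨h4, h2⟩⟩
  rw [Real.dist_eq]
  exact (abs_toReal_measure_sub_le haar (measure_ne_top_of_subset inter_subset_left (hfin h))
    (measure_ne_top_of_subset inter_subset_left (hfin h₀))
    (measure_ne_top_of_subset hsub hsd)).trans
    (ENNReal.toReal_mono hsd (measure_mono hsub))

theorem exists_countable_piSystem (α : Type*) [MeasurableSpace α]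
    [MeasurableSpace.CountablyGenerated α] :
    ∃ V : Finset ℕ → Set α, (∀ s, MeasurableSet (V s)) ∧ V ∅ = univ ∧ IsPiSystem (range V) ∧
      MeasurableSpace.generateFrom (range V) = ‹MeasurableSpace α› := by
  classical
  let V : Finset ℕ → Set α := fun s => ⋂ i ∈ s, MeasurableSpace.natGeneratingSequence α i
  have hV : ∀ s, MeasurableSet (V s) := fun s =>
    Finset.measurableSet_biInter s
      fun i _ => MeasurableSpace.measurableSet_natGeneratingSequence i
  refine ⟨V, hV, by simp [V], ?_, le_antisymm ?_ ?_⟩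
  · rintro _ ⟨s, rfl⟩ _ ⟨t, rfl⟩ -
    exact ⟨s ∪ t, by ext; simp [V, or_imp, forall_and]⟩
  · refine MeasurableSpace.generateFrom_le ?_
    rintro _ ⟨s, rfl⟩
    exact hV s
  · conv_lhs => rw [← MeasurableSpace.generateFrom_natGeneratingSequence α]
    refine MeasurableSpace.generateFrom_mono ?_
    rintro _ ⟨i, rfl⟩
    exact ⟨{i}, by simp [V]⟩

theorem measure_sdiff_eq_zero_of_restrict_eq {α : Type*} [MeasurableSpace α] {μ : Measure α}
    {s t : Set α} (hs : MeasurableSet s) (ht : MeasurableSet t)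
    (h : μ.restrict s = μ.restrict t) : μ (s \ t) = 0 := by
  have h1 : μ.restrict s (s \ t) = μ (s \ t) := by
    rw [Measure.restrict_apply (hs.diff ht), inter_eq_left.2 sdiff_subset]
  have h2 : μ.restrict t (s \ t) = 0 := by
    rw [Measure.restrict_apply (hs.diff ht), sdiff_inter_self, measure_empty]
  rw [← h1, h, h2]

/-- A Borel action of a locally compact group embeds in a space of real sequences by a map which
is continuous along orbits. -/
theorem exists_orbit_continuous_injection (haar : Measure G) [haar.IsHaarMeasure]
    (X : Type*) [MeasurableSpace X] [MeasurableSpace.CountablySeparated X] [MulAction G X]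
    [MeasurableSMul₂ G X] :
    ∃ F : X → (ℕ × Finset ℕ × ℕ → ℝ), Measurable F ∧ Function.Injective F ∧
      ∀ x, Continuous fun g : G => F (g • x) := by
  obtain ⟨f, hf, hfinj⟩ := MeasurableSpace.measurable_injection_nat_bool_of_countablySeparated X
  obtain ⟨V, hVm, hV0, hVpi, hVgen⟩ := exists_countable_piSystem G
  let W := spanningSets haar
  have hW : ∀ n, MeasurableSet (W n) := measurableSet_spanningSets haar
  let B : ℕ → X → Set G := fun i x => {g | f (g⁻¹ • x) i = true}
  have hB' : ∀ i, MeasurableSet {p : X × G | f (p.2⁻¹ • p.1) i = true} := fun i =>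
    ((measurable_pi_apply i).comp (hf.comp
      (measurable_snd.inv.smul measurable_fst))) (measurableSet_singleton true)
  have hB : ∀ i x, MeasurableSet (B i x) := fun i x => measurable_prodMk_left (hB' i)
  -- The coordinates record the Haar measure of `B i x` inside countably many windows. They
  -- determine each `B i x` up to a null set, and averaging over `g` provides the continuity along
  -- orbits.
  refine ⟨fun x j => (haar ((W j.1 ∩ V j.2.1) ∩ B j.2.2 x)).toReal, ?_, ?_, ?_⟩
  · refine measurable_pi_lambda _ fun j => ENNReal.measurable_toReal.comp ?_
    have : MeasurableSet {p : X × G | p.2 ∈ W j.1 ∩ V j.2.1 ∧ f (p.2⁻¹ • p.1) j.2.2 = true} :=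
      (measurable_snd ((hW _).inter (hVm _))).inter (hB' _)
    exact measurable_measure_prodMk_left this
  · intro x y hxy
    have hres : ∀ n i, haar.restrict (W n ∩ B i x) = haar.restrict (W n ∩ B i y) := by
      intro n i
      have hfin : ∀ z, haar (W n ∩ B i z) < ∞ := fun z =>
        (measure_mono inter_subset_left).trans_lt (measure_spanningSets_lt_top haar n)
      have : IsFiniteMeasure (haar.restrict (W n ∩ B i x)) :=
        ⟨by rw [Measure.restrict_apply_univ]; exact hfin x⟩
      have hVs : ∀ s, haar.restrict (W n ∩ B i x) (V s) = haar.restrict (W n ∩ B i y) (V s) := by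
        intro s
        rw [Measure.restrict_apply (hVm s), Measure.restrict_apply (hVm s)]
        have e : ∀ z, V s ∩ (W n ∩ B i z) = W n ∩ V s ∩ B i z := fun z => by
          rw [← inter_assoc, inter_comm (V s)]
        rw [e, e, ← ENNReal.toReal_eq_toReal_iff' ?_ ?_]
        · exact congrFun hxy (n, s, i)
        · exact measure_ne_top_of_subset
            (inter_subset_inter_left _ inter_subset_left) (hfin x).ne
        · exact measure_ne_top_of_subset
            (inter_subset_inter_left _ inter_subset_left) (hfin y).ne
      refine ext_of_generate_finite (range V) hVgen.symm hVpi ?_ ?_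
      · rintro _ ⟨s, rfl⟩
        exact hVs s
      · rw [← hV0]
        exact hVs ∅
    have hae : ∀ᵐ g ∂haar, ∀ n i, g ∉ (W n ∩ B i x) \ (W n ∩ B i y) ∧
        g ∉ (W n ∩ B i y) \ (W n ∩ B i x) := by
      rw [ae_all_iff]
      intro n
      rw [ae_all_iff]
      intro i
      have hx := (hW n).inter (hB i x)
      have hy := (hW n).inter (hB i y)
      exact (measure_eq_zero_iff_ae_notMem.1
        (measure_sdiff_eq_zero_of_restrict_eq hx hy (hres n i))).and
        (measure_eq_zero_iff_ae_notMem.1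
        (measure_sdiff_eq_zero_of_restrict_eq hy hx (hres n i).symm))
    -- One `g` avoids all the countably many null sets, so `g⁻¹ • x` and `g⁻¹ • y` have the same
    -- code under `f`.
    obtain ⟨g, hg⟩ := hae.exists
    obtain ⟨n, hn⟩ : ∃ n, g ∈ W n := by
      have : g ∈ ⋃ n, W n := by rw [iUnion_spanningSets]; trivial
      exact mem_iUnion.1 this
    have : g⁻¹ • x = g⁻¹ • y := by
      apply hfinj
      funext i
      have hi := hg n i
      have h1 : g ∈ B i x ↔ g ∈ B i y := by
        constructor
        · intro h
          by_contra h'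
          exact hi.1 ⟨⟨hn, h⟩, fun h2 => h' h2.2⟩
        · intro h
          by_contra h'
          exact hi.2 ⟨⟨hn, h⟩, fun h2 => h' h2.2⟩
      exact Bool.eq_iff_iff.2 h1
    exact smul_left_cancel _ this
  · intro x
    refine continuous_pi fun j => ?_
    -- Since `B i (h • x) = h (B i x)`, left invariance moves the translation from `B` to the
    -- window.
    have := continuous_toReal_measure_mul_left_preimage_inter haar ((hW j.1).inter (hVm j.2.1))
      (measure_ne_top_of_subset inter_subset_left (measure_spanningSets_lt_top haar j.1).ne)
      (B j.2.2 x)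
    convert this using 3 with h
    rw [← measure_preimage_mul haar h]
    congr 1
    ext g
    simp [B, mul_smul]

end OrbitContinuous

/-! ### Measurable selection depending on the set alone. -/

section Selection

variable {E : Type*} [MetricSpace E]

/-- The sets obtained from `S` by intersecting successively with the first ball of radius `2⁻ⁿ`
around a point of the sequence `q` that meets the set. -/
noncomputable def shrinkingSets (q : ℕ → E) (S : Set E) : ℕ → Set E
  | 0 => S
  | n + 1 => shrinkingSets q S n ∩ Metric.ball
      (q (sInf {j | (shrinkingSets q S n ∩ Metric.ball (q j) ((1 / 2) ^ n)).Nonempty}))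
      ((1 / 2) ^ n)

/-- The index of the ball chosen at stage `n` in `shrinkingSets`. -/
noncomputable def shrinkingIndex (q : ℕ → E) (S : Set E) (n : ℕ) : ℕ :=
  sInf {j | (shrinkingSets q S n ∩ Metric.ball (q j) ((1 / 2) ^ n)).Nonempty}

theorem shrinkingSets_succ (q : ℕ → E) (S : Set E) (n : ℕ) :
    shrinkingSets q S (n + 1) =
      shrinkingSets q S n ∩ Metric.ball (q (shrinkingIndex q S n)) ((1 / 2) ^ n) := rfl

theorem nonempty_shrinkingSets {q : ℕ → E} (hq : DenseRange q) {S : Set E} (hS : S.Nonempty)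
    (n : ℕ) : (shrinkingSets q S n).Nonempty := by
  induction n with
  | zero => exact hS
  | succ n ih =>
    rw [shrinkingSets_succ]
    obtain ⟨x, hx⟩ := ih
    obtain ⟨j, hj⟩ := hq.exists_dist_lt x (ε := (1 / 2) ^ n) (by positivity)
    exact Nat.sInf_mem (s := {j | (shrinkingSets q S n ∩
      Metric.ball (q j) ((1 / 2) ^ n)).Nonempty}) ⟨j, x, hx, hj⟩

theorem shrinkingSets_subset (q : ℕ → E) (S : Set E) (n : ℕ) : shrinkingSets q S n ⊆ S := by
  induction n with
  | zero => exact subset_rfl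
  | succ n ih => exact inter_subset_left.trans ih

theorem exists_tendsto_shrinkingIndex [CompleteSpace E] {q : ℕ → E} (hq : DenseRange q)
    {S : Set E} (hS : S.Nonempty) :
    ∃ p ∈ closure S, Tendsto (fun n => q (shrinkingIndex q S n)) atTop (𝓝 p) := by
  have hc : CauchySeq fun n => q (shrinkingIndex q S n) := by
    refine cauchySeq_of_le_geometric (1 / 2) 2 (by norm_num) fun n => ?_
    obtain ⟨x, hx⟩ := nonempty_shrinkingSets hq hS (n + 2)
    have h1 : dist x (q (shrinkingIndex q S (n + 1))) < (1 / 2) ^ (n + 1) := hx.2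
    have h2 : dist x (q (shrinkingIndex q S n)) < (1 / 2) ^ n := hx.1.2
    have h3 := dist_triangle_left (q (shrinkingIndex q S n)) (q (shrinkingIndex q S (n + 1))) x
    have h4 : ((1 : ℝ) / 2) ^ (n + 1) ≤ (1 / 2) ^ n :=
      pow_le_pow_of_le_one (by norm_num) (by norm_num) (Nat.le_succ n)
    linarith
  obtain ⟨p, hp⟩ := cauchySeq_tendsto_of_complete hc
  choose x hx using fun n => nonempty_shrinkingSets hq hS (n + 1)
  have hxp : Tendsto x atTop (𝓝 p) := by
    refine hp.congr_dist (squeeze_zero (fun _ => dist_nonneg) (fun n => ?_)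
      (tendsto_pow_atTop_nhds_zero_of_lt_one (r := (1 / 2 : ℝ)) (by norm_num) (by norm_num)))
    rw [dist_comm]
    exact (show dist (x n) _ < _ from (hx n).2).le
  exact ⟨p, mem_closure_of_tendsto hxp
    (Eventually.of_forall fun n => shrinkingSets_subset q S (n + 1) (hx n)), hp⟩

theorem measurable_nat_sInf {X : Type*} [MeasurableSpace X] {P : X → ℕ → Prop}
    (hP : ∀ j, MeasurableSet {x | P x j}) : Measurable fun x => sInf {j | P x j} := by
  refine measurable_to_countable' fun j => ?_
  -- The second set accounts for the convention `sInf ∅ = 0`.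
  have : (fun x => sInf {j | P x j}) ⁻¹' {j} =
      ({x | P x j} ∩ ⋂ i < j, {x | P x i}ᶜ) ∪ ({x | j = 0} ∩ ⋂ i, {x | P x i}ᶜ) := by
    ext x
    simp only [mem_preimage, mem_singleton_iff, mem_union, mem_inter_iff, mem_ofPred_eq, mem_iInter,
      mem_compl_iff]
    constructor
    · rintro rfl
      by_cases h : {j | P x j}.Nonempty
      · exact Or.inl ⟨Nat.sInf_mem h, fun i hi => Nat.notMem_of_lt_sInf hi⟩
      · rw [not_nonempty_iff_eq_empty] at h
        exact Or.inr ⟨by rw [h, Nat.sInf_empty], fun i hi => by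
          have : i ∈ {j | P x j} := hi
          rwa [h] at this⟩
    · rintro (⟨h1, h2⟩ | ⟨rfl, h2⟩)
      · refine le_antisymm (Nat.sInf_le h1) (le_csInf ⟨j, h1⟩ fun i hi => ?_)
        by_contra hlt
        exact h2 i (not_le.1 hlt) hi
      · rw [eq_empty_of_forall_notMem (s := {j | P x j}) h2, Nat.sInf_empty]
  rw [this]
  exact ((hP j).inter (MeasurableSet.biInter (to_countable _) fun i _ => (hP i).compl)).union
    ((MeasurableSet.const _).inter (MeasurableSet.iInter fun i => (hP i).compl))

/-- A Kuratowski–Ryll-Nardzewski selection which depends on the set only. -/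
theorem exists_measurable_selection (E : Type*) [MetricSpace E] [CompleteSpace E]
    [SecondCountableTopology E] [MeasurableSpace E] [BorelSpace E] [Nonempty E]
    (X : Type*) [MeasurableSpace X] :
    ∃ sel : Set E → E, (∀ S : Set E, S.Nonempty → sel S ∈ closure S) ∧
      ∀ T : X → Set E, (∀ V : Set E, IsOpen V → MeasurableSet {x | (T x ∩ V).Nonempty}) →
        Measurable fun x => sel (T x) := by
  let q : ℕ → E := TopologicalSpace.denseSeq E
  have hq : DenseRange q := TopologicalSpace.denseRange_denseSeq E
  refine ⟨fun S => limUnder atTop fun n => q (shrinkingIndex q S n), fun S hS => ?_,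
    fun T hT => ?_⟩
  · obtain ⟨p, hp, hlim⟩ := exists_tendsto_shrinkingIndex hq hS
    change limUnder atTop (fun n => q (shrinkingIndex q S n)) ∈ closure S
    rwa [hlim.limUnder_eq]
  · have hidx : ∀ n, (∀ V : Set E, IsOpen V →
        MeasurableSet {x | (shrinkingSets q (T x) n ∩ V).Nonempty}) →
        Measurable fun x => shrinkingIndex q (T x) n := fun n h =>
      measurable_nat_sInf fun j => h _ Metric.isOpen_ball
    have hsets : ∀ n, ∀ V : Set E, IsOpen V →
        MeasurableSet {x | (shrinkingSets q (T x) n ∩ V).Nonempty} := by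
      intro n
      induction n with
      | zero => exact hT
      | succ n ih =>
        intro V hV
        have : {x | (shrinkingSets q (T x) (n + 1) ∩ V).Nonempty} =
            ⋃ j, (fun x => shrinkingIndex q (T x) n) ⁻¹' {j} ∩
              {x | (shrinkingSets q (T x) n ∩ (Metric.ball (q j) ((1 / 2) ^ n) ∩ V)).Nonempty} := by
          ext x
          simp [shrinkingSets_succ, inter_assoc]
        rw [this]
        exact MeasurableSet.iUnion fun j => (hidx n ih (measurableSet_singleton j)).inter
          (ih _ (Metric.isOpen_ball.inter hV))
    have hm : ∀ n, StronglyMeasurable fun x => q (shrinkingIndex q (T x) n) := fun n =>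
      ((measurable_from_nat (f := q)).comp (hidx n (hsets n))).stronglyMeasurable
    exact (StronglyMeasurable.limUnder hm).measurable

end Selection

/-! ### Lacunary cross sections of free actions. -/

section CrossSection

variable {G : Type*} [Group G] [TopologicalSpace G] [IsTopologicalGroup G]
  [T2Space G] [LocallyCompactSpace G] [SecondCountableTopology G] [MeasurableSpace G] [BorelSpace G]
  {X : Type*} [MeasurableSpace X] [MulAction G X] [MeasurableSMul₂ G X]
  {E : Type*} [MetricSpace E] [SecondCountableTopology E] [MeasurableSpace E] [BorelSpace E]
  {F : X → E}

/-- On a compact set the continuous displacement attains its minimum, so a strict bound holds with a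
margin `1 / (n + 1)`, and a non-strict bound need only be tested on a countable dense set. -/
theorem measurableSet_forall_lt_dist (hF : Measurable F)
    (hFc : ∀ x, Continuous fun g : G => F (g • x)) {L : Set G} (hL : IsCompact L) (c : ℝ) :
    MeasurableSet {x | ∀ k ∈ L, c < dist (F (k • x)) (F x)} := by
  obtain ⟨D, hDc, hD⟩ := TopologicalSpace.exists_countable_dense L
  have heq : {x | ∀ k ∈ L, c < dist (F (k • x)) (F x)} =
      ⋃ n : ℕ, ⋂ k ∈ D, {x | c + 1 / ((n : ℝ) + 1) ≤ dist (F ((k : G) • x)) (F x)} := by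
    ext x
    simp only [mem_ofPred_eq, mem_iUnion, mem_iInter]
    have hcont : Continuous fun k : G => dist (F (k • x)) (F x) :=
      (hFc x).dist continuous_const
    constructor
    · intro h
      rcases L.eq_empty_or_nonempty with rfl | hne
      · exact ⟨0, fun k => absurd k.2 (notMem_empty _)⟩
      · obtain ⟨k₀, hk₀, hmin⟩ := hL.exists_isMinOn hne hcont.continuousOn
        obtain ⟨n, hn⟩ := exists_nat_one_div_lt (sub_pos.2 (h k₀ hk₀))
        refine ⟨n, fun k _ => ?_⟩
        have := hmin k.2
        simp only [mem_ofPred_eq] at this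
        linarith
    · rintro ⟨n, hn⟩ k hk
      have hclosed : IsClosed {k : L | c + 1 / ((n : ℝ) + 1) ≤ dist (F ((k : G) • x)) (F x)} :=
        isClosed_le continuous_const (hcont.comp continuous_subtype_val)
      have := hclosed.closure_subset_iff.2 (fun k hk => hn k hk) (hD ⟨k, hk⟩)
      have h2 : (0 : ℝ) < 1 / ((n : ℝ) + 1) := by positivity
      simp only [mem_ofPred_eq] at this
      linarith
  rw [heq]
  refine MeasurableSet.iUnion fun n => MeasurableSet.biInter hDc fun k _ => ?_
  exact measurableSet_le measurable_const ((hF.comp (measurable_const_smul (k : G))).dist hF)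

theorem isOpen_forall_lt_dist (hFc : ∀ x, Continuous fun g : G => F (g • x)) {L : Set G}
    (hL : IsCompact L) (c : ℝ) (x : X) :
    IsOpen {g : G | ∀ k ∈ L, c < dist (F (k • g • x)) (F (g • x))} := by
  rw [isOpen_iff_mem_nhds]
  intro g hg
  refine hL.eventually_forall_of_forall_eventually
    (P := fun g k => c < dist (F (k • g • x)) (F (g • x))) fun k hk => ?_
  have hcont : Continuous fun p : G × G => dist (F (p.2 • p.1 • x)) (F (p.1 • x)) := by
    simp_rw [← mul_smul]
    exact ((hFc x).comp (continuous_snd.mul continuous_fst)).dist ((hFc x).comp continuous_fst)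
  exact (isOpen_lt continuous_const hcont).mem_nhds (hg k hk)

/-- Openness along orbits lets the quantifier over `U` be restricted to a countable dense subset. -/
theorem measurableSet_exists_smul_mem {A : Set X} (hA : MeasurableSet A)
    (hAo : ∀ x, IsOpen {g : G | g • x ∈ A}) {U : Set G} (hU : IsOpen U) :
    MeasurableSet {x : X | ∃ g ∈ U, g • x ∈ A} := by
  obtain ⟨D, hDc, hD⟩ := TopologicalSpace.exists_countable_dense G
  have : {x : X | ∃ g ∈ U, g • x ∈ A} = ⋃ d ∈ D ∩ U, (fun x => d • x) ⁻¹' A := by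
    ext x
    simp only [mem_ofPred_eq, mem_iUnion, mem_preimage, exists_prop]
    constructor
    · rintro ⟨g, hg, hgx⟩
      obtain ⟨d, hd, hdD⟩ := hD.exists_mem_open (hU.inter (hAo x)) ⟨g, hg, hgx⟩
      exact ⟨d, ⟨hd, hdD.1⟩, hdD.2⟩
    · rintro ⟨d, hd, hdx⟩
      exact ⟨d, hd.2, hdx⟩
  rw [this]
  exact MeasurableSet.biUnion (hDc.mono inter_subset_left)
    fun d _ => measurable_const_smul d hA

theorem exists_orbit_open_section [Nonempty E] (hF : Measurable F) (hFinj : Function.Injective F)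
    (hFc : ∀ x, Continuous fun g : G => F (g • x)) (hfree : ∀ (g : G) (x : X), g • x = x → g = 1)
    {L : Set G} (hL : IsCompact L) (h1 : (1 : G) ∉ L) :
    ∃ A : Set X, MeasurableSet A ∧ (∀ x, IsOpen {g : G | g • x ∈ A}) ∧
      (∀ x, ∃ g : G, g • x ∈ A) ∧ ∀ x ∈ A, ∀ k ∈ L, k • x ∉ A := by
  let q : ℕ → E := TopologicalSpace.denseSeq E
  have hq : DenseRange q := TopologicalSpace.denseRange_denseSeq E
  let ε : ℕ → ℝ := fun j => 1 / ((j.unpair.1 : ℝ) + 1)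
  -- Two points of `A' j` have `F`-values less than `2 * ε j` apart, whereas `L` displaces by more;
  -- hence no return through `L`.
  let A' : ℕ → Set X := fun j => {x | (∀ k ∈ L, 2 * ε j < dist (F (k • x)) (F x)) ∧
    dist (F x) (q j.unpair.2) < ε j}
  have hA'm : ∀ j, MeasurableSet (A' j) := fun j =>
    (measurableSet_forall_lt_dist hF hFc hL _).inter
      (measurableSet_lt (hF.dist measurable_const) measurable_const)
  have hA'o : ∀ j x, IsOpen {g : G | g • x ∈ A' j} := fun j x =>
    (isOpen_forall_lt_dist hFc hL _ x).inter
      (isOpen_lt ((hFc x).dist continuous_const) continuous_const)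
  let sat : ℕ → Set X := fun j => {x | ∃ g ∈ (univ : Set G), g • x ∈ A' j}
  have hsat : ∀ j, MeasurableSet (sat j) := fun j =>
    measurableSet_exists_smul_mem (hA'm j) (hA'o j) isOpen_univ
  have hsat' : ∀ j (g : G) x, g • x ∈ sat j ↔ x ∈ sat j := by
    intro j g x
    constructor
    · rintro ⟨h, -, hh⟩
      exact ⟨h * g, trivial, by rwa [mul_smul]⟩
    · rintro ⟨h, -, hh⟩
      exact ⟨h * g⁻¹, trivial, by rwa [mul_smul, inv_smul_smul]⟩
  have hcover : ∀ x, ∃ j, x ∈ A' j := by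
    intro x
    obtain ⟨n, hn⟩ : ∃ n : ℕ, ∀ k ∈ L, 2 * (1 / ((n : ℝ) + 1)) < dist (F (k • x)) (F x) := by
      rcases L.eq_empty_or_nonempty with rfl | hne
      · exact ⟨0, fun k hk => absurd hk (notMem_empty _)⟩
      · have hcont : Continuous fun k : G => dist (F (k • x)) (F x) :=
          (hFc x).dist continuous_const
        obtain ⟨k₀, hk₀, hmin⟩ := hL.exists_isMinOn hne hcont.continuousOn
        have hpos : 0 < dist (F (k₀ • x)) (F x) := by
          refine dist_pos.2 fun h => h1 ?_
          rw [← hfree k₀ x (hFinj h)]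
          exact hk₀
        obtain ⟨n, hn⟩ := exists_nat_one_div_lt (half_pos hpos)
        refine ⟨n, fun k hk => ?_⟩
        have := hmin hk
        simp only [mem_ofPred_eq] at this
        linarith
    obtain ⟨m, hm⟩ := hq.exists_dist_lt (F x) (ε := 1 / ((n : ℝ) + 1)) (by positivity)
    refine ⟨Nat.pair n m, ?_, ?_⟩
    · simpa [ε] using hn
    · simpa [ε] using hm
  -- The saturations are invariant, so each orbit uses only the least `j` whose `A' j` it meets.
  refine ⟨⋃ j, A' j ∩ ⋂ i < j, (sat i)ᶜ, ?_, ?_, ?_, ?_⟩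
  · exact MeasurableSet.iUnion fun j => (hA'm j).inter
      (MeasurableSet.biInter (to_countable _) fun i _ => (hsat i).compl)
  · intro x
    have : {g : G | g • x ∈ ⋃ j, A' j ∩ ⋂ i < j, (sat i)ᶜ} =
        ⋃ j, {g : G | g • x ∈ A' j} ∩ {_g | ∀ i < j, x ∉ sat i} := by
      ext g
      simp [hsat']
    rw [this]
    exact isOpen_iUnion fun j => (hA'o j x).inter isOpen_const
  · intro x
    classical
    have hex : ∃ j, x ∈ sat j := (hcover x).imp fun j hj => ⟨1, trivial, by rwa [one_smul]⟩
    obtain ⟨g, -, hg⟩ := Nat.find_spec hex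
    refine ⟨g, mem_iUnion.2 ⟨Nat.find hex, hg, ?_⟩⟩
    simp only [mem_iInter, mem_compl_iff, hsat']
    exact fun i hi => Nat.find_min hex hi
  · intro x hx k hk hkx
    obtain ⟨j, hj, hj'⟩ := mem_iUnion.1 hx
    obtain ⟨i, hi, hi'⟩ := mem_iUnion.1 hkx
    simp only [mem_iInter, mem_compl_iff, hsat'] at hj' hi'
    have hij : i = j := by
      rcases lt_trichotomy i j with h | h | h
      · exact absurd ⟨k, trivial, hi⟩ (hj' i h)
      · exact h
      · exact absurd ⟨1, trivial, by rwa [one_smul]⟩ (hi' j h)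
    subst hij
    have h1 := hj.1 k hk
    have h2 := dist_triangle_right (F (k • x)) (F x) (q i.unpair.2)
    have h3 := hj.2
    have h4 := hi.2
    linarith

/-- A free Borel action of a locally compact group has a Borel set meeting every orbit whose
return times avoid a given compact set. -/
theorem exists_lacunary_section [CompleteSpace E] [Nonempty E] (hF : Measurable F)
    (hFinj : Function.Injective F)
    (hFc : ∀ x, Continuous fun g : G => F (g • x)) (hfree : ∀ (g : G) (x : X), g • x = x → g = 1)
    {S : Set G} (hS : IsCompact S) :
    ∃ Z : Set X, MeasurableSet Z ∧ (∀ x, ∃ g : G, g • x ∈ Z) ∧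
      ∀ z ∈ Z, ∀ k ∈ S, k • z ∈ Z → k = 1 := by
  obtain ⟨N, hNc, hN⟩ := exists_compact_mem_nhds (1 : G)
  let U : Set G := interior N ∩ (interior N)⁻¹
  have hUo : IsOpen U := isOpen_interior.inter isOpen_interior.inv
  have hU1 : (1 : G) ∈ U := ⟨mem_interior_iff_mem_nhds.2 hN, by
    rw [Set.mem_inv, inv_one]; exact mem_interior_iff_mem_nhds.2 hN⟩
  have hUinv : ∀ u ∈ U, u⁻¹ ∈ U := fun u hu => ⟨hu.2, by rw [Set.mem_inv, inv_inv]; exact hu.1⟩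
  have hUN : U ⊆ N := inter_subset_left.trans interior_subset
  have hUc : IsCompact (closure U) := hNc.closure_of_subset hUN
  -- Avoiding `L` forces any return of `A` through `N * N` or `N * S * N` to lie in `U`: the first
  -- makes nearness an equivalence relation on the clumps of `A`, the second separates clumps at the
  -- scale of `S`.
  let L : Set G := (N * N ∪ N * S * N) \ U
  have hL : IsCompact L := ((hNc.mul hNc).union ((hNc.mul hS).mul hNc)).diff hUo
  obtain ⟨A, hAm, hAo, hAne, hAL⟩ :=
    exists_orbit_open_section hF hFinj hFc hfree hL fun h => h.2 hU1
  have hAU : ∀ x ∈ A, ∀ k : G, k • x ∈ A → k ∈ N * N ∪ N * S * N → k ∈ U := by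
    intro x hx k hkx hk
    by_contra hkU
    exact hAL x hx k ⟨hk, hkU⟩ hkx
  obtain ⟨sel, hsel, hselm⟩ := exists_measurable_selection E X
  -- `C x` is the `F`-image of the clump of `x`. It is the same set for all points of a clump, hence
  -- so is the selected point `p x`.
  let C : X → Set E := fun x => (fun u : G => F (u • x)) '' {u | u ∈ U ∧ u • x ∈ A}
  let p : X → E := fun x => sel (C x)
  have hp : Measurable p := by
    refine hselm C fun V hV => ?_
    convert measurableSet_exists_smul_mem (hAm.inter (hF hV.measurableSet))
      (fun x => (hAo x).inter (hV.preimage (hFc x))) hUo using 1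
    ext x
    constructor
    · rintro ⟨_, ⟨u, ⟨hu, hux⟩, rfl⟩, huV⟩
      exact ⟨u, hu, hux, huV⟩
    · rintro ⟨u, hu, hux, huV⟩
      exact ⟨_, ⟨u, ⟨hu, hux⟩, rfl⟩, huV⟩
  have hCsub : ∀ x ∈ A, ∀ k ∈ U, k • x ∈ A → C x ⊆ C (k • x) := by
    rintro x hx k hk hkx _ ⟨u, ⟨hu, hux⟩, rfl⟩
    have e : (u * k⁻¹) • k • x = u • x := by rw [mul_smul, inv_smul_smul]
    refine ⟨u * k⁻¹, ⟨hAU (k • x) hkx _ (by rwa [e])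
      (Or.inl (mul_mem_mul (hUN hu) (hUN (hUinv k hk)))), by rwa [e]⟩, ?_⟩
    simp only [e]
  have hpeq : ∀ x ∈ A, ∀ k ∈ U, k • x ∈ A → p (k • x) = p x := by
    intro x hx k hk hkx
    have h2 := hCsub (k • x) hkx k⁻¹ (hUinv k hk) (by rwa [inv_smul_smul])
    rw [inv_smul_smul] at h2
    exact congrArg sel (h2.antisymm (hCsub x hx k hk hkx))
  obtain ⟨D, hDc, hD⟩ := TopologicalSpace.exists_countable_dense G
  -- The selected point lies only in the closure of the clump, perhaps outside `A`. Thus `z` is tied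
  -- to `A` through a small translate, taken from `D` to keep the set Borel.
  refine ⟨{z | ∃ d ∈ D ∩ U, d • z ∈ A ∧ F z = p (d • z)}, ?_, ?_, ?_⟩
  · have : {z : X | ∃ d ∈ D ∩ U, d • z ∈ A ∧ F z = p (d • z)} =
        ⋃ d ∈ D ∩ U, ((fun z => d • z) ⁻¹' A ∩ {z | F z = p (d • z)}) := by
      ext z
      simp only [mem_ofPred_eq, mem_iUnion, mem_inter_iff, mem_preimage, exists_prop]
    rw [this]
    exact MeasurableSet.biUnion (hDc.mono inter_subset_left) fun d _ =>
      (measurable_const_smul d hAm).inter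
        (measurableSet_eq_fun hF (hp.comp (measurable_const_smul d)))
  · intro x
    obtain ⟨g, hg⟩ := hAne x
    have hne : (C (g • x)).Nonempty :=
      ⟨_, 1, ⟨hU1, by rwa [one_smul]⟩, rfl⟩
    have hcl : IsCompact (closure {u | u ∈ U ∧ u • g • x ∈ A}) :=
      hUc.of_isClosed_subset isClosed_closure (closure_mono fun u hu => hu.1)
    have hmem : p (g • x) ∈ closure (C (g • x)) := hsel _ hne
    rw [← image_closure_of_isCompact hcl (hFc (g • x)).continuousOn] at hmem
    obtain ⟨u, hu, hup⟩ := hmem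
    -- The selected value is `F (u • g • x)` with `u` a limit of some `v` in the clump. A small `w`
    -- near `v * u⁻¹` brings that point back into `A`, and openness allows `w` in `D`.
    have hopen : IsOpen {w : G | w ∈ U ∧ w * u ∈ U ∧ w • u • g • x ∈ A} :=
      hUo.inter ((hUo.preimage (continuous_mul_const u)).inter (hAo (u • g • x)))
    have hnhds : (fun w : G => w * u⁻¹) ⁻¹' U ∈ 𝓝 u :=
      (hUo.preimage (continuous_mul_const u⁻¹)).mem_nhds (by simpa using hU1)
    obtain ⟨v, hvU, hv⟩ := mem_closure_iff_nhds.1 hu _ hnhds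
    obtain ⟨d, hd, hdD⟩ := hD.exists_mem_open hopen
      ⟨v * u⁻¹, hvU, by simpa using hv.1, by rw [smul_smul, inv_mul_cancel_right]; exact hv.2⟩
    refine ⟨u * g, d, ⟨hd, hdD.1⟩, ?_, ?_⟩
    · rw [mul_smul]; exact hdD.2.2
    · rw [mul_smul, smul_smul d u, hpeq (g • x) hg (d * u) hdD.2.1
        (by rw [mul_smul]; exact hdD.2.2)]
      exact hup
  -- The nearby points of `A` differ by an element of `N * S * N`, so they share a clump and `F z =
  -- F (k • z)`.
  · rintro z ⟨d, hd, hdz, hFz⟩ k hk ⟨d', hd', hdz', hFz'⟩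
    have e : (d' * k * d⁻¹) • d • z = d' • k • z := by
      rw [mul_smul, inv_smul_smul, mul_smul]
    have hkU : d' * k * d⁻¹ ∈ U := hAU (d • z) hdz _ (by rwa [e])
      (Or.inr (mul_mem_mul (mul_mem_mul (hUN hd'.2) hk) (hUN (hUinv d hd.2))))
    have := hpeq (d • z) hdz _ hkU (by rwa [e])
    rw [e, ← hFz, ← hFz'] at this
    exact hfree k z (hFinj this)

end CrossSection

/-! ### Measurability and local finiteness of visit counts. -/

namespace Config

variable {G : Type*} [TopologicalSpace G] [MeasurableSpace G]

theorem measurable_count {U : Set G} (hU : MeasurableSet U) :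
    Measurable fun ω : Config G => (count U ω : ℝ≥0∞) := by
  have h1 : @Measurable _ _ _ ⊤ (count U : Config G → ℕ∞) :=
    measurable_iff_comap_le.2
      (le_iSup₂ (f := fun (U : Set G) (_ : MeasurableSet U) =>
        MeasurableSpace.comap (count U) ⊤) U hU)
  exact (measurable_from_top (f := fun n : ℕ∞ => (n : ℝ≥0∞))).comp h1

theorem measurable_of_count {X : Type*} [MeasurableSpace X] {f : X → Config G}
    (h : ∀ U : Set G, MeasurableSet U → Measurable fun x => (count U (f x) : ℝ≥0∞)) :
    Measurable f := by
  rw [measurable_iff_comap_le, MeasurableSpace.comap_le_iff_le_map]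
  refine iSup₂_le fun U hU => ?_
  rintro _ ⟨s, -, rfl⟩
  have : (fun x => (count U (f x) : ℝ≥0∞)) ⁻¹' ((fun n : ℕ∞ => (n : ℝ≥0∞)) '' s) =
      f ⁻¹' (count U ⁻¹' s) := by
    ext x
    simp
  rw [MeasurableSpace.map_def, ← this]
  exact h U hU ((to_countable s).image _).measurableSet

end Config

theorem Set.Subsingleton.encard_coe_eq_indicator {α β : Type*} {s : β → Set α}
    (hs : ∀ b, (s b).Subsingleton) (b : β) :
    ((s b).encard : ℝ≥0∞) = {b | (s b).Nonempty}.indicator 1 b := by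
  classical
  rw [indicator_apply]
  split_ifs with h
  · obtain ⟨a, ha⟩ := h
    rw [(hs b).eq_singleton_of_mem ha, encard_singleton]
    simp
  · have h' : s b = ∅ := not_nonempty_iff_eq_empty.1 h
    simp [h']

section Visits

variable {G : Type*} [Group G] [TopologicalSpace G] [IsTopologicalGroup G]
  {X : Type*} [MulAction G X]

theorem subsingleton_visits_inter_smul {Z : Set X} {S O : Set G}
    (hsep : ∀ z ∈ Z, ∀ k ∈ S, k • z ∈ Z → k = 1) (hO : O⁻¹ * O ⊆ S) (x : X) (d : G) :
    ({g : G | g⁻¹ • x ∈ Z} ∩ d • O).Subsingleton := by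
  rintro _ ⟨hg, a, ha, rfl⟩ _ ⟨hh, b, hb, rfl⟩
  have e : ((d • b)⁻¹ * (d • a)) • (d • a)⁻¹ • x = (d • b)⁻¹ • x := by
    rw [mul_smul, smul_inv_smul]
  have hk : (d • b)⁻¹ * (d • a) ∈ S := by
    refine hO ?_
    have : (d • b)⁻¹ * (d • a) = b⁻¹ * a := by simp [mul_assoc]
    rw [this]
    exact mul_mem_mul (Set.inv_mem_inv.2 hb) ha
  have := hsep _ hg _ hk (by rw [e]; exact hh)
  exact (inv_mul_eq_one.1 this).symm

theorem exists_open_inv_mul_subset {S : Set G} (hS : S ∈ 𝓝 (1 : G)) :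
    ∃ O : Set G, IsOpen O ∧ (1 : G) ∈ O ∧ O⁻¹ * O ⊆ S := by
  have hcont : Continuous fun p : G × G => p.1⁻¹ * p.2 := by fun_prop
  have h : (fun p : G × G => p.1⁻¹ * p.2) ⁻¹' S ∈ 𝓝 ((1 : G), (1 : G)) :=
    hcont.continuousAt.preimage_mem_nhds (by simpa using hS)
  rw [nhds_prod_eq, Filter.mem_prod_self_iff] at h
  obtain ⟨T, hT, hTS⟩ := h
  refine ⟨interior T, isOpen_interior, mem_interior_iff_mem_nhds.2 hT, ?_⟩
  rintro _ ⟨a, ha, b, hb, rfl⟩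
  have := hTS (mk_mem_prod (interior_subset ha) (interior_subset hb))
  simpa using this

/-- Finitely many translates of `O` cover `K`, and each contains at most one visit, whatever `x` is.
-/
theorem exists_encard_visits_le {Z : Set X} {S : Set G} (hS : S ∈ 𝓝 (1 : G))
    (hsep : ∀ z ∈ Z, ∀ k ∈ S, k • z ∈ Z → k = 1) {K : Set G} (hK : IsCompact K) :
    ∃ n : ℕ, ∀ x : X, ({g : G | g⁻¹ • x ∈ Z} ∩ K).encard ≤ n := by
  obtain ⟨O, hO, hO1, hOS⟩ := exists_open_inv_mul_subset hS
  obtain ⟨t, ht⟩ := hK.elim_finite_subcover (fun d : G => d • O) (fun d => hO.smul d)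
    fun g _ => mem_iUnion.2 ⟨g, 1, hO1, by simp⟩
  refine ⟨t.card, fun x => ?_⟩
  have hd : ∀ g ∈ K, ∃ d ∈ t, g ∈ d • O := fun g hg => by
    simpa only [mem_iUnion, exists_prop] using ht hg
  choose! d hdt hdO using hd
  rw [← Set.encard_coe_eq_coe_finsetCard]
  refine Set.encard_le_encard_of_injOn (f := d) (fun g hg => hdt g hg.2) ?_
  intro g hg h hh hgh
  refine subsingleton_visits_inter_smul hsep hOS x (d g) ⟨hg.1, hdO g hg.2⟩ ⟨hh.1, ?_⟩
  rw [hgh]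
  exact hdO h hh.2

variable [T2Space G] [LocallyCompactSpace G] [SecondCountableTopology G] [MeasurableSpace G]
  [BorelSpace G] [MeasurableSpace X] [StandardBorelSpace X] [MeasurableSMul₂ G X]

/-- Cut `G` into countably many Borel pieces with at most one visit each. The points `x` with a
visit in a given piece form an injective projection of a Borel set, which is Borel by Lusin–Souslin.
-/
theorem measurable_encard_visits {Z : Set X} (hZ : MeasurableSet Z) {S : Set G}
    (hS : S ∈ 𝓝 (1 : G)) (hsep : ∀ z ∈ Z, ∀ k ∈ S, k • z ∈ Z → k = 1) {B : Set (X × G)}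
    (hB : MeasurableSet B) :
    Measurable fun x : X => (({g : G | g⁻¹ • x ∈ Z ∧ (x, g) ∈ B}.encard : ℕ∞) : ℝ≥0∞) := by
  have := polishSpace_of_locallyCompact_group G
  obtain ⟨O, hO, hO1, hOS⟩ := exists_open_inv_mul_subset hS
  obtain ⟨D, hDc, hD⟩ := TopologicalSpace.countable_cover_nhds (f := fun d : G => d • O)
    fun d => (hO.smul d).mem_nhds ⟨1, hO1, by simp⟩
  have hDne : D.Nonempty := by
    obtain ⟨d, hd, -⟩ : ∃ d ∈ D, (1 : G) ∈ d • O := by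
      have : (1 : G) ∈ ⋃ d ∈ D, d • O := by rw [hD]; trivial
      simpa only [mem_iUnion, exists_prop] using this
    exact ⟨d, hd⟩
  obtain ⟨d, rfl⟩ := hDc.exists_eq_range hDne
  let P : ℕ → Set G := disjointed fun i => d i • O
  have hPm : ∀ i, MeasurableSet (P i) :=
    MeasurableSet.disjointed fun i => (hO.smul (d i)).measurableSet
  have hPu : ⋃ i, P i = univ := by
    rw [iUnion_disjointed, ← hD, biUnion_range]
  have hPd : Pairwise (Function.onFun Disjoint P) := disjoint_disjointed _
  let C : Set (X × G) := {p | p.2⁻¹ • p.1 ∈ Z} ∩ B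
  have hC : MeasurableSet C := ((measurable_snd.inv.smul measurable_fst) hZ).inter hB
  let v : X → Set G := fun x => {g | g⁻¹ • x ∈ Z ∧ (x, g) ∈ B}
  have hv : ∀ x, MeasurableSet (v x) := fun x => measurable_prodMk_left hC
  have hsub : ∀ i x, (v x ∩ P i).Subsingleton := fun i x =>
    (subsingleton_visits_inter_smul hsep hOS x (d i)).anti
      (inter_subset_inter (fun g hg => hg.1) (disjointed_subset _ i))
  have hsum : ∀ x, ((v x).encard : ℝ≥0∞) = ∑' i, ((v x ∩ P i).encard : ℝ≥0∞) := by
    intro x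
    have h1 : v x = ⋃ i, v x ∩ P i := by rw [← inter_iUnion, hPu, inter_univ]
    rw [← Measure.count_apply (hv x)]
    conv_lhs => rw [h1]
    rw [measure_iUnion (fun i j hij => (hPd hij).mono inter_subset_right inter_subset_right)
      fun i => (hv x).inter (hPm i)]
    exact tsum_congr fun i => Measure.count_apply ((hv x).inter (hPm i))
  change Measurable fun x => ((v x).encard : ℝ≥0∞)
  simp_rw [hsum]
  refine Measurable.tsum fun i => ?_
  simp_rw [Set.Subsingleton.encard_coe_eq_indicator (hsub i)]
  refine measurable_one.indicator ?_
  have himg : {x | (v x ∩ P i).Nonempty} = Prod.fst '' (C ∩ Prod.snd ⁻¹' P i) := by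
    ext x
    constructor
    · rintro ⟨g, hg, hgP⟩
      exact ⟨(x, g), ⟨hg, hgP⟩, rfl⟩
    · rintro ⟨⟨x, g⟩, ⟨hg, hgP⟩, rfl⟩
      exact ⟨g, hg, hgP⟩
  rw [himg]
  refine (hC.inter (measurable_snd (hPm i))).image_of_measurable_injOn measurable_fst ?_
  rintro ⟨x, g⟩ ⟨hg, hgP⟩ ⟨y, h⟩ ⟨hh, hhP⟩ (rfl : x = y)
  exact Prod.ext rfl (hsub i x ⟨hg, hgP⟩ ⟨hh, hhP⟩)

end Visits

/-! ### Encoding points of a free action as configurations. -/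

section Encoding

/-- Haar measure on a nondiscrete group has no atoms, so countable sets are null, while nonempty
open sets have positive measure. -/
theorem not_countable_of_isOpen {G : Type*} [Group G] [TopologicalSpace G] [IsTopologicalGroup G]
    [T2Space G] [LocallyCompactSpace G] [MeasurableSpace G] [BorelSpace G]
    (hG : ¬ DiscreteTopology G) {O : Set G} (hO : IsOpen O) (hne : O.Nonempty) :
    ¬ O.Countable := by
  intro hc
  have : (𝓝[≠] (1 : G)).NeBot := by
    rw [neBot_iff]
    intro h
    exact hG (discreteTopology_of_isOpen_singleton_one (isOpen_singleton_iff_punctured_nhds 1 |>.2 h))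
  have := hO.measure_pos (Measure.haar : Measure G) hne
  exact this.ne' (hc.measure_zero _)

variable {G : Type*} [Group G] [TopologicalSpace G] [IsTopologicalGroup G]
  [T2Space G] [LocallyCompactSpace G] [SecondCountableTopology G] [MeasurableSpace G] [BorelSpace G]

/-- An element `s` and an uncountable compact set `R` such that the position of `1` in a set
`{1, s, ρ}` with `ρ ∈ R` can be recovered from a translate of that set. -/
theorem exists_rigid_pattern (hG : ¬ DiscreteTopology G) :
    ∃ (s : G) (R : Set G), IsCompact R ∧ ¬ R.Countable ∧ s ≠ 1 ∧
      ∀ ρ ∈ R, ρ ≠ 1 ∧ ρ ≠ s ∧ ρ * s ≠ 1 ∧ s * s ≠ ρ ∧ ∀ ρ' ∈ R, s * ρ ≠ ρ' := by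
  have hnt : Nontrivial G := by
    by_contra h
    rw [not_nontrivial_iff_subsingleton] at h
    exact hG inferInstance
  obtain ⟨s, hs⟩ := exists_ne (1 : G)
  -- Avoiding these four values gives the first four conditions on `ρ`; separating `ρ₀` from `s *
  -- ρ₀` makes `s R` and `R` disjoint.
  let B : Set G := {1, s, s⁻¹, s * s}
  have hBf : B.Finite := toFinite _
  obtain ⟨ρ₀, hρ₀⟩ : Bᶜ.Nonempty := by
    rw [nonempty_compl]
    intro h
    exact not_countable_of_isOpen hG isOpen_univ univ_nonempty (h ▸ hBf.countable)
  obtain ⟨O₁, O₂, hO₁, hO₂, h₁, h₂, hdisj⟩ := t2_separation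
    (show ρ₀ ≠ s * ρ₀ from fun h => hs (by simpa using h.symm))
  have hW : IsOpen (O₁ ∩ (fun g => s * g) ⁻¹' O₂ ∩ Bᶜ) :=
    (hO₁.inter (hO₂.preimage (continuous_const_mul s))).inter hBf.isClosed.isOpen_compl
  obtain ⟨R, hR, hρR, hRW⟩ := exists_compact_subset hW ⟨⟨h₁, h₂⟩, hρ₀⟩
  refine ⟨s, R, hR, fun hc => not_countable_of_isOpen hG isOpen_interior ⟨ρ₀, hρR⟩
    (hc.mono interior_subset), hs, fun ρ hρ => ?_⟩
  have hB : ρ ∉ B := (hRW hρ).2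
  simp only [B, mem_insert_iff, mem_singleton_iff, not_or] at hB
  refine ⟨hB.1, hB.2.1, fun h => hB.2.2.1 (eq_inv_of_mul_eq_one_left h), fun h => hB.2.2.2 h.symm,
    fun ρ' hρ' h => ?_⟩
  exact disjoint_left.1 hdisj (hRW hρ').1.1 (h ▸ (hRW hρ).1.2)

theorem exists_measurable_injection_into {X R : Type*} [MeasurableSpace X] [StandardBorelSpace X]
    [MeasurableSpace R] [StandardBorelSpace R] (hR : ¬ Countable R) :
    ∃ r : X → R, Measurable r ∧ Function.Injective r := by
  obtain ⟨f, hf⟩ := exists_measurableEmbedding_real X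
  let e : ℝ ≃ᵐ R := PolishSpace.measurableEquivOfNotCountable (not_countable_iff.2 inferInstance) hR
  exact ⟨e ∘ f, e.measurable.comp hf.measurable, e.injective.comp hf.injective⟩

variable {X : Type*} [MulAction G X]

/-- The points `g`, `g s` and `g r(g⁻¹ x)`, where `g` runs over the visits `g⁻¹ x ∈ Z`. -/
def patternSet (Z : Set X) (s : G) (r : X → G) (x : X) : Set G :=
  {h | ∃ g : G, g⁻¹ • x ∈ Z ∧ (h = g ∨ h = g * s ∨ h = g * r (g⁻¹ • x))}

theorem patternSet_smul (Z : Set X) (s : G) (r : X → G) (k : G) (x : X) :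
    patternSet Z s r (k • x) = (fun h => k * h) '' patternSet Z s r x := by
  ext h
  constructor
  · rintro ⟨g, hg, hh⟩
    have e : (k⁻¹ * g)⁻¹ • x = g⁻¹ • k • x := by rw [mul_inv_rev, inv_inv, mul_smul]
    refine ⟨k⁻¹ * h, ⟨k⁻¹ * g, by rwa [e], ?_⟩, by simp⟩
    rw [e]
    rcases hh with rfl | rfl | rfl
    · exact Or.inl rfl
    · exact Or.inr (Or.inl (mul_assoc _ _ _).symm)
    · exact Or.inr (Or.inr (mul_assoc _ _ _).symm)
  · rintro ⟨_, ⟨g, hg, hh⟩, rfl⟩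
    have e : (k * g)⁻¹ • k • x = g⁻¹ • x := by rw [mul_inv_rev, mul_smul, inv_smul_smul]
    refine ⟨k * g, by rwa [e], ?_⟩
    rw [e]
    rcases hh with rfl | rfl | rfl
    · exact Or.inl rfl
    · exact Or.inr (Or.inl (mul_assoc _ _ _).symm)
    · exact Or.inr (Or.inr (mul_assoc _ _ _).symm)

/-- A free Borel action of a nondiscrete locally compact group embeds equivariantly in the space
of configurations, with a uniform bound on the number of points in each compact set. -/
theorem exists_equivariant_injection_config (hG : ¬ DiscreteTopology G)
    [MeasurableSpace X] [StandardBorelSpace X] [MeasurableSMul₂ G X]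
    (hfree : ∀ (g : G) (x : X), g • x = x → g = 1) :
    ∃ Φ : X → Config G, Measurable Φ ∧ Function.Injective Φ ∧
      (∀ (g : G) (x : X), Φ (g • x) = g • Φ x) ∧
      ∀ K : Set G, IsCompact K → ∃ n : ℕ, ∀ x, Config.count K (Φ x) ≤ n := by
  obtain ⟨s, R, hR, hRc, hs, hpat⟩ := exists_rigid_pattern hG
  have := polishSpace_of_locallyCompact_group G
  have : StandardBorelSpace R := hR.measurableSet.standardBorel
  obtain ⟨r', hr'm, hr'inj⟩ := exists_measurable_injection_into (X := X) (R := R) hRc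
  obtain ⟨r, hrm, hrinj, hrR⟩ : ∃ r : X → G, Measurable r ∧ Function.Injective r ∧ ∀ x, r x ∈ R :=
    ⟨fun x => r' x, measurable_subtype_coe.comp hr'm, Subtype.val_injective.comp hr'inj,
      fun x => (r' x).2⟩
  obtain ⟨N, hNc, hN⟩ := exists_compact_mem_nhds (1 : G)
  let P : Set G := {1, s} ∪ R
  have hP : IsCompact P := (toFinite _).isCompact.union hR
  have hP1 : (1 : G) ∈ P := Or.inl (Or.inl rfl)
  have hPs : s ∈ P := Or.inl (Or.inr rfl)
  have hPR : ∀ ρ ∈ R, ρ ∈ P := fun ρ hρ => Or.inr hρ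
  -- The factor `P * P * P⁻¹` separates clusters, even after a further translation by `P`; `N` makes
  -- `S` a neighbourhood of `1`.
  let S : Set G := P * P * P⁻¹ ∪ N
  have hS : IsCompact S := ((hP.mul hP).mul hP.inv).union hNc
  have hS1 : S ∈ 𝓝 (1 : G) := mem_of_superset hN subset_union_right
  obtain ⟨Z, hZm, hZne, hsep⟩ : ∃ Z : Set X, MeasurableSet Z ∧ (∀ x, ∃ g : G, g • x ∈ Z) ∧
      ∀ z ∈ Z, ∀ k ∈ S, k • z ∈ Z → k = 1 := by
    obtain ⟨F, hFm, hFinj, hFc⟩ := exists_orbit_continuous_injection (Measure.haar : Measure G) X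
    let := TopologicalSpace.upgradeIsCompletelyMetrizable (ℕ × Finset ℕ × ℕ → ℝ)
    exact exists_lacunary_section hFm hFinj hFc hfree hS
  have hclus : ∀ x (g h : G), g⁻¹ • x ∈ Z → h⁻¹ • x ∈ Z → ∀ a ∈ P, ∀ b ∈ P, ∀ c ∈ P,
      h * b = g * a * c → h = g := by
    intro x g h hg hh a ha b hb c hc e
    have e1 : g⁻¹ * h = a * c * b⁻¹ := by
      rw [eq_mul_inv_iff_mul_eq, mul_assoc, e, mul_assoc, inv_mul_cancel_left]
    have := hsep _ hh (g⁻¹ * h)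
      (Or.inl (e1 ▸ mul_mem_mul (mul_mem_mul ha hc) (Set.inv_mem_inv.2 hb)))
      (by rwa [mul_smul, smul_inv_smul])
    exact (inv_mul_eq_one.1 this).symm
  have hclus' : ∀ x (g h : G), g⁻¹ • x ∈ Z → h⁻¹ • x ∈ Z → ∀ a ∈ P, ∀ b ∈ P,
      h * b = g * a → h = g := fun x g h hg hh a ha b hb e =>
    hclus x g h hg hh a ha b hb 1 hP1 (by rwa [mul_one])
  have hmem : ∀ x h, h ∈ patternSet Z s r x → ∃ g : G, g⁻¹ • x ∈ Z ∧ ∃ a ∈ P, h = g * a ∧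
      (a = 1 ∨ a = s ∨ a = r (g⁻¹ • x)) := by
    rintro x h ⟨g, hg, rfl | rfl | rfl⟩
    · exact ⟨h, hg, 1, hP1, (mul_one _).symm, Or.inl rfl⟩
    · exact ⟨g, hg, s, hPs, rfl, Or.inr (Or.inl rfl)⟩
    · exact ⟨g, hg, _, hPR _ (hrR _), rfl, Or.inr (Or.inr rfl)⟩
  -- The three points must come from one cluster, based at some `h`, with `g = h * a`. The pattern
  -- inequalities exclude `a = s` and `a = r (h⁻¹ • x)`, leaving `g = h`.
  have hdecode : ∀ x g, ∀ ρ ∈ R, g ∈ patternSet Z s r x → g * s ∈ patternSet Z s r x →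
      g * ρ ∈ patternSet Z s r x → g⁻¹ • x ∈ Z ∧ r (g⁻¹ • x) = ρ := by
    intro x g ρ hρ h1 h2 h3
    obtain ⟨h, hh, a, ha, rfl, hca⟩ := hmem x g h1
    obtain ⟨h', hh', b, hb, hb', hcb⟩ := hmem x _ h2
    obtain ⟨h'', hh'', c, hc, hc', hcc⟩ := hmem x _ h3
    obtain rfl := hclus x h h' hh hh' a ha b hb s hPs hb'.symm
    obtain rfl := hclus x h' h'' hh hh'' a ha c hc ρ (hPR ρ hρ) hc'.symm
    rw [mul_assoc, mul_right_inj] at hb' hc'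
    subst hb' hc'
    obtain ⟨p1, p2, p3, p4, p5⟩ := hpat _ (hrR (h''⁻¹ • x))
    obtain ⟨q1, q2, q3, q4, q5⟩ := hpat ρ hρ
    rcases hca with rfl | rfl | rfl
    · simp only [one_mul] at hcc
      rw [mul_one]
      refine ⟨hh, ?_⟩
      rcases hcc with h | h | h
      · exact absurd h q1
      · exact absurd h q2
      · exact h.symm
    · exfalso
      rcases hcb with h | h | h
      · rcases hcc with h' | h' | h'
        · exact q2 (mul_left_cancel (h'.trans h.symm))
        · exact q1 (by simpa using h')
        · exact q5 _ (hrR _) h'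
      · exact hs (by simpa using h)
      · exact p4 h
    · exfalso
      rcases hcb with h | h | h
      · exact p3 h
      · exact p1 (by simpa using h)
      · exact hs (by simpa using h)
  have hbound : ∀ K : Set G, IsCompact K →
      ∃ n : ℕ, ∀ x, (patternSet Z s r x ∩ K).encard ≤ n := by
    intro K hK
    obtain ⟨n, hn⟩ := exists_encard_visits_le hS1 hsep (hK.mul hP.inv)
    -- Each visit contributes three points, and only visits in `K * P⁻¹` can contribute to `K`.
    refine ⟨n + (n + n), fun x => ?_⟩
    let A : Set G := {g : G | g⁻¹ • x ∈ Z} ∩ (K * P⁻¹)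
    have hA : ∀ g : G, g⁻¹ • x ∈ Z → ∀ a ∈ P, g * a ∈ K → g ∈ A := fun g hg a ha hK =>
      ⟨hg, g * a, hK, a⁻¹, Set.inv_mem_inv.2 ha, mul_inv_cancel_right g a⟩
    have hsub : patternSet Z s r x ∩ K ⊆
        A ∪ ((fun g => g * s) '' A ∪ (fun g => g * r (g⁻¹ • x)) '' A) := by
      rintro h ⟨⟨g, hg, rfl | rfl | rfl⟩, hK⟩
      · exact Or.inl (hA h hg 1 hP1 (by rwa [mul_one]))
      · exact Or.inr (Or.inl ⟨g, hA g hg s hPs hK, rfl⟩)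
      · exact Or.inr (Or.inr ⟨g, hA g hg _ (hPR _ (hrR _)) hK, rfl⟩)
    have hAn : A.encard ≤ n := hn x
    push_cast
    exact (encard_le_encard hsub).trans ((encard_union_le _ _).trans (add_le_add hAn
      ((encard_union_le _ _).trans (add_le_add ((encard_image_le _ _).trans hAn)
        ((encard_image_le _ _).trans hAn)))))
  let Φ : X → Config G := fun x => ⟨patternSet Z s r x, fun K hK => by
    obtain ⟨n, hn⟩ := hbound K hK
    exact finite_of_encard_le_coe (hn x)⟩
  refine ⟨Φ, Config.measurable_of_count fun V hV => ?_, fun x y hxy => ?_, fun g x => ?_, hbound⟩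
  · let A₀ : X → Set G := fun x => {g | g⁻¹ • x ∈ Z ∧ (x, g) ∈ {p : X × G | p.2 ∈ V}}
    let A₁ : X → Set G := fun x => {g | g⁻¹ • x ∈ Z ∧ (x, g) ∈ {p : X × G | p.2 * s ∈ V}}
    let A₂ : X → Set G := fun x =>
      {g | g⁻¹ • x ∈ Z ∧ (x, g) ∈ {p : X × G | p.2 * r (p.2⁻¹ • p.1) ∈ V}}
    have heq : ∀ x, (Config.count V (Φ x) : ℝ≥0∞) =
        (A₀ x).encard + ((A₁ x).encard + (A₂ x).encard) := by
      intro x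
      have e : patternSet Z s r x ∩ V =
          A₀ x ∪ ((fun g => g * s) '' A₁ x ∪ (fun g => g * r (g⁻¹ • x)) '' A₂ x) := by
        ext h
        constructor
        · rintro ⟨⟨g, hg, rfl | rfl | rfl⟩, hV⟩
          · exact Or.inl ⟨hg, hV⟩
          · exact Or.inr (Or.inl ⟨g, ⟨hg, hV⟩, rfl⟩)
          · exact Or.inr (Or.inr ⟨g, ⟨hg, hV⟩, rfl⟩)
        · rintro (⟨hg, hV⟩ | ⟨g, ⟨hg, hV⟩, rfl⟩ | ⟨g, ⟨hg, hV⟩, rfl⟩)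
          · exact ⟨⟨h, hg, Or.inl rfl⟩, hV⟩
          · exact ⟨⟨g, hg, Or.inr (Or.inl rfl)⟩, hV⟩
          · exact ⟨⟨g, hg, Or.inr (Or.inr rfl)⟩, hV⟩
      have d1 : Disjoint ((fun g => g * s) '' A₁ x) ((fun g => g * r (g⁻¹ • x)) '' A₂ x) := by
        rw [disjoint_left]
        rintro _ ⟨g, hg, rfl⟩ ⟨h, hh, he⟩
        obtain rfl := hclus' x g h hg.1 hh.1 s hPs _ (hPR _ (hrR _)) he
        exact (hpat _ (hrR _)).2.1 (mul_left_cancel he)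
      have d0 : Disjoint (A₀ x)
          ((fun g => g * s) '' A₁ x ∪ (fun g => g * r (g⁻¹ • x)) '' A₂ x) := by
        rw [disjoint_left]
        rintro g hg (⟨h, hh, he⟩ | ⟨h, hh, he⟩)
        · obtain rfl := hclus' x g h hg.1 hh.1 1 hP1 _ hPs (by rwa [mul_one])
          exact hs (by simpa using he)
        · obtain rfl := hclus' x g h hg.1 hh.1 1 hP1 _ (hPR _ (hrR _)) (by rwa [mul_one])
          exact (hpat _ (hrR _)).1 (by simpa using he)
      have i2 : InjOn (fun g => g * r (g⁻¹ • x)) (A₂ x) := fun g hg h hh he =>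
        hclus' x h g hh.1 hg.1 _ (hPR _ (hrR _)) _ (hPR _ (hrR _)) he
      change (((patternSet Z s r x ∩ V).encard : ℕ∞) : ℝ≥0∞) = _
      rw [e, encard_union_eq d0, encard_union_eq d1, (mul_left_injective s).injOn.encard_image,
        i2.encard_image]
      push_cast
      rfl
    simp_rw [heq]
    refine (measurable_encard_visits hZm hS1 hsep (measurable_snd hV)).add
      ((measurable_encard_visits hZm hS1 hsep ((measurable_snd.mul_const s) hV)).add
      (measurable_encard_visits hZm hS1 hsep ?_))
    exact (measurable_snd.mul (hrm.comp (measurable_snd.inv.smul measurable_fst))) hV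
  · have hset : patternSet Z s r x = patternSet Z s r y := congrArg Subtype.val hxy
    obtain ⟨g, hg⟩ := hZne x
    have hg' : (g⁻¹)⁻¹ • x ∈ Z := by rwa [inv_inv]
    obtain ⟨-, h2⟩ := hdecode y g⁻¹ (r ((g⁻¹)⁻¹ • x)) (hrR _)
      (hset ▸ ⟨g⁻¹, hg', Or.inl rfl⟩) (hset ▸ ⟨g⁻¹, hg', Or.inr (Or.inl rfl)⟩)
      (hset ▸ ⟨g⁻¹, hg', Or.inr (Or.inr rfl)⟩)
    exact (smul_left_cancel _ (hrinj h2)).symm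
  · exact Subtype.ext (patternSet_smul Z s r g x)

end Encoding

/-! ### Separating configurations by countably many counts. -/

section LocallyFinite

variable {G : Type*} [TopologicalSpace G]

theorem exists_countableBasis_isolating [T2Space G] [LocallyCompactSpace G]
    [SecondCountableTopology G] {A : Set G} (hA : ∀ K : Set G, IsCompact K → (A ∩ K).Finite)
    (p : G) : ∃ V ∈ TopologicalSpace.countableBasis G, p ∈ V ∧ A ∩ V ⊆ {p} := by
  obtain ⟨K, hK, hpK⟩ := exists_compact_mem_nhds p
  have hfin : ((A ∩ K) \ {p}).Finite := (hA K hK).subset sdiff_subset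
  have hO : IsOpen (interior K ∩ ((A ∩ K) \ {p})ᶜ) :=
    isOpen_interior.inter hfin.isClosed.isOpen_compl
  obtain ⟨V, hV, hpV, hVO⟩ := (TopologicalSpace.isBasis_countableBasis G).exists_subset_of_mem_open
    (show p ∈ interior K ∩ ((A ∩ K) \ {p})ᶜ from
      ⟨mem_interior_iff_mem_nhds.2 hpK, fun h => h.2 rfl⟩) hO
  refine ⟨V, hV, hpV, fun a ha => ?_⟩
  by_contra hne
  exact (hVO ha.2).2 ⟨⟨ha.1, interior_subset (hVO ha.2).1⟩, hne⟩

theorem Config.exists_count_ne [T2Space G] [LocallyCompactSpace G]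
    [SecondCountableTopology G] {ω ω' : Config G} {p : G} (hp : p ∈ ω.1) (hp' : p ∉ ω'.1) :
    ∃ V ∈ TopologicalSpace.countableBasis G, Config.count V ω ≠ Config.count V ω' := by
  obtain ⟨V, hV, hpV, hiso⟩ := exists_countableBasis_isolating (A := ω.1 ∪ ω'.1)
    (fun K hK => by rw [union_inter_distrib_right]; exact (ω.2 K hK).union (ω'.2 K hK)) p
  refine ⟨V, hV, ?_⟩
  have h' : ω'.1 ∩ V = ∅ := eq_empty_of_forall_notMem fun a ha => by
    obtain rfl : a = p := hiso ⟨Or.inr ha.1, ha.2⟩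
    exact hp' ha.1
  rw [Config.count, Config.count, h', encard_empty]
  exact (encard_pos.2 (⟨p, hp, hpV⟩ : (ω.1 ∩ V).Nonempty)).ne'

theorem Config.countablySeparated [T2Space G] [LocallyCompactSpace G]
    [SecondCountableTopology G] [MeasurableSpace G] [BorelSpace G] :
    MeasurableSpace.CountablySeparated (Config G) := by
  refine ⟨⟨⋃ V ∈ TopologicalSpace.countableBasis G, ⋃ n : ℕ∞, {Config.count V ⁻¹' {n}}, ?_, ?_, ?_⟩⟩
  · exact (TopologicalSpace.countable_countableBasis G).biUnion fun V _ =>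
      countable_iUnion fun n => countable_singleton _
  · intro s hs
    simp only [mem_iUnion, mem_singleton_iff, exists_prop] at hs
    obtain ⟨V, hV, n, rfl⟩ := hs
    have hVm := ((TopologicalSpace.isBasis_countableBasis G).isOpen hV).measurableSet
    convert Config.measurable_count hVm (measurableSet_singleton (n : ℝ≥0∞)) using 1
    ext ω
    simp
  · intro ω _ ω' _ h
    have hc : ∀ V ∈ TopologicalSpace.countableBasis G, Config.count V ω = Config.count V ω' := by
      intro V hV
      have := h (Config.count V ⁻¹' {Config.count V ω})
        (mem_biUnion hV (mem_iUnion.2 ⟨_, rfl⟩))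
      exact (this.1 rfl).symm
    apply Subtype.ext
    ext p
    constructor
    · intro hp
      by_contra hp'
      obtain ⟨V, hV, hne⟩ := Config.exists_count_ne hp hp'
      exact hne (hc V hV)
    · intro hp
      by_contra hp'
      obtain ⟨V, hV, hne⟩ := Config.exists_count_ne hp hp'
      exact hne (hc V hV).symm

end LocallyFinite

/-! ### Mean measure and intensity. -/

section Intensity

variable {G : Type*} [Group G] [TopologicalSpace G] [IsTopologicalGroup G] [MeasurableSpace G]
  [BorelSpace G]

theorem Config.count_smul (U : Set G) (g : G) (ω : Config G) :
    Config.count U (g • ω) = Config.count ((fun x => g * x) ⁻¹' U) ω := by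
  change ((fun x => g * x) '' ω.1 ∩ U).encard = (ω.1 ∩ (fun x => g * x) ⁻¹' U).encard
  rw [← image_inter_preimage]
  exact ((mul_right_injective g).injOn).encard_image

theorem Config.measurable_const_smul (g : G) : Measurable fun ω : Config G => g • ω := by
  refine Config.measurable_of_count fun U hU => ?_
  simp_rw [Config.count_smul]
  exact Config.measurable_count ((measurable_const_mul g) hU)

theorem Config.countable [SigmaCompactSpace G] (ω : Config G) : ω.1.Countable := by
  have : ω.1 = ⋃ n, ω.1 ∩ compactCovering G n := by
    rw [← inter_iUnion, iUnion_compactCovering, inter_univ]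
  rw [this]
  exact countable_iUnion fun n => (ω.2 _ (isCompact_compactCovering G n)).countable

/-- An invariant point process whose mean measure is locally finite has an intensity. -/
theorem exists_hasIntensity [T2Space G] [LocallyCompactSpace G] [SecondCountableTopology G]
    (haar : Measure G) [haar.IsHaarMeasure] {ν : Measure (Config G)}
    [SMulInvariantMeasure G (Config G) ν]
    (hfin : ∀ K : Set G, IsCompact K → ∫⁻ ω, (Config.count K ω : ℝ≥0∞) ∂ν < ∞) :
    ∃ c : ℝ≥0∞, c < ∞ ∧ HasIntensity haar ν c := by
  let M : Config G → Measure G := fun ω => Measure.count.restrict ω.1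
  have hM : ∀ ω, ∀ U : Set G, MeasurableSet U → M ω U = (Config.count U ω : ℝ≥0∞) := by
    intro ω U hU
    rw [Measure.restrict_apply hU, Measure.count_apply (hU.inter ω.countable.measurableSet),
      inter_comm]
    rfl
  have hMm : Measurable M := Measure.measurable_of_measurable_coe _ fun U hU => by
    simp_rw [hM _ U hU]
    exact Config.measurable_count hU
  -- This is the mean measure; its left invariance and local finiteness make uniqueness of Haar
  -- measure applicable.
  let η : Measure G := ν.bind M
  have hη : ∀ U : Set G, MeasurableSet U → η U = ∫⁻ ω, (Config.count U ω : ℝ≥0∞) ∂ν := by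
    intro U hU
    rw [Measure.bind_apply hU hMm.aemeasurable]
    simp_rw [hM _ U hU]
  have : IsFiniteMeasureOnCompacts η := ⟨fun K hK => by
    rw [hη K hK.measurableSet]
    exact hfin K hK⟩
  have : η.IsMulLeftInvariant := ⟨fun g => by
    ext U hU
    have hmp : MeasurePreserving (fun ω : Config G => g • ω) ν ν :=
      ⟨Config.measurable_const_smul g, by
        ext s hs
        rw [Measure.map_apply (Config.measurable_const_smul g) hs,
          SMulInvariantMeasure.measure_preimage_smul g hs]⟩
    rw [Measure.map_apply (measurable_const_mul g) hU, hη _ (measurable_const_mul g hU), hη _ hU,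
      ← hmp.lintegral_comp (Config.measurable_count hU)]
    simp_rw [Config.count_smul]⟩
  have hsmul := Measure.isMulLeftInvariant_eq_smul η haar
  refine ⟨η.haarScalarFactor haar, ENNReal.coe_lt_top, fun U hU h0 htop => ?_⟩
  rw [← hη U hU]
  conv_lhs => rw [hsmul]
  rw [Measure.smul_apply, ENNReal.smul_def, smul_eq_mul, ENNReal.mul_div_cancel_right h0 htop]

end Intensity

/-! ### Transport of the measure along an equivariant embedding. -/

section Transfer

variable {G : Type*} [Group G] {X Y : Type*} [MulAction G X] [MulAction G Y]
  [MeasurableSpace X] [MeasurableSpace Y]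

/-- An equivariant measurable embedding of an invariant set of full measure transports the measure
to an abstractly isomorphic one. -/
theorem exists_abstractlyIsomorphic_map (μ : Measure X) [IsProbabilityMeasure μ]
    [SMulInvariantMeasure G X μ] {X₀ : Set X} (hX₀ : MeasurableSet X₀) (hμ : μ X₀ᶜ = 0)
    (hinv : ∀ (g : G), ∀ x ∈ X₀, g • x ∈ X₀) {Φ : X₀ → Y} (hΦ : MeasurableEmbedding Φ)
    (heq : ∀ (g : G) (x : X₀) (h : g • (x : X) ∈ X₀), Φ ⟨g • (x : X), h⟩ = g • Φ x) :
    IsProbabilityMeasure ((μ.comap Subtype.val).map Φ) ∧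
      SMulInvariantMeasure G Y ((μ.comap Subtype.val).map Φ) ∧
      AbstractlyIsomorphic G μ ((μ.comap Subtype.val).map Φ) := by
  have hval : MeasurableEmbedding (Subtype.val : X₀ → X) := MeasurableEmbedding.subtype_coe hX₀
  have happ : ∀ s, (μ.comap Subtype.val).map Φ s = μ (Subtype.val '' (Φ ⁻¹' s)) := fun s => by
    rw [hΦ.map_apply, hval.comap_apply]
  have hcoe : ∀ x, (hΦ.equivRange x : Y) = Φ x := fun x => by
    rw [hΦ.equivRange_apply]
  have hX₀1 : μ X₀ = 1 := (prob_compl_eq_zero_iff hX₀).1 hμ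
  have hrange : ∀ g : G, ∀ y ∈ range Φ, g • y ∈ range Φ := by
    rintro g _ ⟨x, rfl⟩
    exact ⟨⟨g • (x : X), hinv g x x.2⟩, heq g x _⟩
  refine ⟨⟨by rw [happ]; simpa using hX₀1⟩, ⟨fun g s hs => ?_⟩, X₀, range Φ,
    hΦ.equivRange, hX₀, hΦ.measurableSet_range, hμ, ?_, hinv, hrange, fun g x h => ?_, ?_⟩
  · rw [happ, happ, ← SMulInvariantMeasure.measure_preimage_smul (μ := μ) g
      (hval.measurableSet_image.2 (hΦ.measurable hs))]
    congr 1
    ext x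
    constructor
    · rintro ⟨x, hx, rfl⟩
      refine ⟨⟨g • (x : X), hinv g x x.2⟩, ?_, rfl⟩
      rw [mem_preimage, heq]
      exact hx
    · rintro ⟨y, hy, hyx⟩
      have hx : x ∈ X₀ := by
        have := hinv g⁻¹ _ y.2
        rwa [hyx, inv_smul_smul] at this
      refine ⟨⟨x, hx⟩, ?_, rfl⟩
      change g • Φ ⟨x, hx⟩ ∈ s
      rw [← heq g ⟨x, hx⟩ (hinv g x hx)]
      have hy' : y = ⟨g • x, hinv g x hx⟩ := Subtype.ext hyx
      rwa [hy'] at hy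
  · rw [happ]
    simp
  · rw [hcoe, hcoe, heq]
  · refine ⟨hΦ.equivRange.measurable, ?_⟩
    ext s hs
    rw [MeasurableEquiv.map_apply,
      (MeasurableEmbedding.subtype_coe hΦ.measurableSet_range).comap_apply,
      hΦ.map_apply]
    congr 1
    ext x
    constructor
    · intro hx
      exact ⟨_, hx, hcoe x⟩
    · rintro ⟨y, hy, hyx⟩
      have : hΦ.equivRange x = y := Subtype.ext ((hcoe x).trans hyx.symm)
      rw [mem_preimage, this]
      exact hy

end Transfer

/-! ### The free part, and the theorem for free actions. -/

section Main

variable {G : Type*} [Group G] [TopologicalSpace G] [IsTopologicalGroup G]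
  [T2Space G] [LocallyCompactSpace G] [SecondCountableTopology G] [MeasurableSpace G] [BorelSpace G]

/-- Exhaust `G \ {1}` by countably many compact sets: the stabiliser is trivial exactly when each of
them displaces `F x` by a positive margin, which is a Borel condition. -/
theorem measurableSet_stabilizer_eq_bot (X : Type*) [MeasurableSpace X]
    [MeasurableSpace.CountablySeparated X] [MulAction G X] [MeasurableSMul₂ G X] :
    MeasurableSet {x : X | MulAction.stabilizer G x = ⊥} := by
  obtain ⟨F, hFm, hFinj, hFc⟩ := exists_orbit_continuous_injection (Measure.haar : Measure G) X
  let := TopologicalSpace.upgradeIsCompletelyMetrizable (ℕ × Finset ℕ × ℕ → ℝ)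
  have : LocallyCompactSpace ({1}ᶜ : Set G) := isOpen_compl_singleton.locallyCompactSpace
  let L : ℕ → Set G := fun n => Subtype.val '' compactCovering ({1}ᶜ : Set G) n
  have hL : ∀ n, IsCompact (L n) := fun n =>
    (isCompact_compactCovering _ n).image continuous_subtype_val
  have heq : {x : X | MulAction.stabilizer G x = ⊥} =
      ⋂ n, ⋃ m : ℕ, {x | ∀ k ∈ L n, 1 / ((m : ℝ) + 1) < dist (F (k • x)) (F x)} := by
    ext x
    simp only [mem_ofPred_eq, mem_iInter, mem_iUnion]
    constructor
    · intro hx n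
      rcases (L n).eq_empty_or_nonempty with he | hne
      · exact ⟨0, fun k hk => by rw [he] at hk; exact absurd hk (notMem_empty k)⟩
      · have hcont : Continuous fun k : G => dist (F (k • x)) (F x) :=
          (hFc x).dist continuous_const
        obtain ⟨k₀, hk₀, hmin⟩ := (hL n).exists_isMinOn hne hcont.continuousOn
        have hpos : 0 < dist (F (k₀ • x)) (F x) := by
          refine dist_pos.2 fun h => ?_
          obtain ⟨k, -, rfl⟩ := hk₀
          have : (k : G) ∈ MulAction.stabilizer G x := hFinj h
          rw [hx, Subgroup.mem_bot] at this
          exact k.2 this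
        obtain ⟨m, hm⟩ := exists_nat_one_div_lt hpos
        exact ⟨m, fun k hk => hm.trans_le (hmin hk)⟩
    · intro h
      rw [Subgroup.eq_bot_iff_forall]
      intro g hg
      by_contra hne
      obtain ⟨n, hn⟩ := exists_mem_compactCovering (⟨g, hne⟩ : ({1}ᶜ : Set G))
      obtain ⟨m, hm⟩ := h n
      have := hm g ⟨_, hn, rfl⟩
      rw [MulAction.mem_stabilizer_iff.1 hg, dist_self] at this
      exact absurd this (not_lt.2 (by positivity))
  rw [heq]
  exact MeasurableSet.iInter fun n => MeasurableSet.iUnion fun m =>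
    measurableSet_forall_lt_dist hFm hFc (hL n) _

/-- Every free probability measure preserving action of a nondiscrete locally compact group is
isomorphic to a point process of finite intensity. -/
theorem exists_pointProcess_abstractlyIsomorphic (hG : ¬ DiscreteTopology G)
    (haar : Measure G) [haar.IsHaarMeasure] (X : Type*) [MeasurableSpace X] [StandardBorelSpace X]
    [MulAction G X] [MeasurableSMul₂ G X] (μ : Measure X) [IsProbabilityMeasure μ]
    [SMulInvariantMeasure G X μ] (hμ : EssentiallyFree G μ) :
    ∃ ν : Measure (Config G), IsPointProcess ν ∧
      (∃ c : ℝ≥0∞, c < ∞ ∧ HasIntensity haar ν c) ∧ AbstractlyIsomorphic G μ ν := by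
  let X₀ : Set X := {x | MulAction.stabilizer G x = ⊥}
  have hX₀ : MeasurableSet X₀ := measurableSet_stabilizer_eq_bot X
  have hinv : ∀ (g : G), ∀ x ∈ X₀, g • x ∈ X₀ := by
    intro g x hx
    change MulAction.stabilizer G (g • x) = ⊥
    rw [Subgroup.eq_bot_iff_forall]
    intro k hk
    have hk' : g⁻¹ * k * g ∈ MulAction.stabilizer G x := by
      rw [MulAction.mem_stabilizer_iff, mul_smul, mul_smul, MulAction.mem_stabilizer_iff.1 hk,
        inv_smul_smul]
    have hx' : MulAction.stabilizer G x = ⊥ := hx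
    rw [hx', Subgroup.mem_bot] at hk'
    rw [mul_assoc, inv_mul_eq_one] at hk'
    exact mul_eq_right.1 hk'.symm
  let : MulAction G X₀ :=
    { smul := fun g x => ⟨g • (x : X), hinv g x x.2⟩
      one_smul := fun x => Subtype.ext (one_smul G (x : X))
      mul_smul := fun g h x => Subtype.ext (mul_smul g h (x : X)) }
  have : MeasurableSMul₂ G X₀ :=
    ⟨(measurable_fst.smul (measurable_subtype_coe.comp measurable_snd)).subtype_mk⟩
  have : StandardBorelSpace X₀ := hX₀.standardBorel
  have hfree : ∀ (g : G) (x : X₀), g • x = x → g = 1 := by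
    intro g x hgx
    have : g ∈ MulAction.stabilizer G (x : X) := congrArg Subtype.val hgx
    rwa [show MulAction.stabilizer G (x : X) = ⊥ from x.2, Subgroup.mem_bot] at this
  obtain ⟨Φ, hΦm, hΦinj, hΦeq, hΦb⟩ := exists_equivariant_injection_config hG hfree
  have := Config.countablySeparated (G := G)
  obtain ⟨hprob, hsmul, hiso⟩ := exists_abstractlyIsomorphic_map μ hX₀ hμ hinv
    (hΦm.measurableEmbedding hΦinj) fun g x _ => hΦeq g x
  refine ⟨_, ⟨hprob, hsmul⟩, exists_hasIntensity haar fun K hK => ?_, hiso⟩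
  obtain ⟨n, hn⟩ := hΦb K hK
  rw [lintegral_map (Config.measurable_count hK.measurableSet) hΦm]
  have : IsProbabilityMeasure (μ.comap (Subtype.val : X₀ → X)) := ⟨by
    rw [(MeasurableEmbedding.subtype_coe hX₀).comap_apply]
    simpa using (prob_compl_eq_zero_iff hX₀).1 hμ⟩
  calc ∫⁻ x, (Config.count K (Φ x) : ℝ≥0∞) ∂(μ.comap (Subtype.val : X₀ → X))
      ≤ ∫⁻ _, (n : ℝ≥0∞) ∂(μ.comap (Subtype.val : X₀ → X)) :=
        lintegral_mono fun x => by simpa using ENat.toENNReal_le.2 (hn x)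
    _ < ∞ := by simp

end Main

theorem MeasurableEquiv.standardBorelSpace {α β : Type*} [MeasurableSpace α] [MeasurableSpace β]
    [StandardBorelSpace α] (e : α ≃ᵐ β) : StandardBorelSpace β := by
  let := upgradeStandardBorel α
  let τ : TopologicalSpace β := TopologicalSpace.induced e.symm inferInstance
  let h : β ≃ₜ α := e.symm.toEquiv.toHomeomorphOfIsInducing ⟨rfl⟩
  have hp : PolishSpace β := h.isClosedEmbedding.polishSpace
  refine ⟨τ, ⟨?_⟩, hp⟩
  rw [borel_comap, ← BorelSpace.measurable_eq]
  exact e.symm.measurableEmbedding.comap_eq.symm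

/-! ### Separating marked configurations by countably many counts. -/

namespace MarkedConfig

variable {G Ξ : Type*} [TopologicalSpace G] [MeasurableSpace G] [MeasurableSpace Ξ]

theorem measurable_count {U : Set (G × Ξ)} (hU : MeasurableSet U) :
    Measurable fun ω : MarkedConfig G Ξ => (count U ω : ℝ≥0∞) := by
  have h1 : @Measurable _ _ _ ⊤ (count U : MarkedConfig G Ξ → ℕ∞) :=
    measurable_iff_comap_le.2
      (le_iSup₂ (f := fun (U : Set (G × Ξ)) (_ : MeasurableSet U) =>
        MeasurableSpace.comap (count U) ⊤) U hU)
  exact (measurable_from_top (f := fun n : ℕ∞ => (n : ℝ≥0∞))).comp h1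

theorem measurable_of_count {X : Type*} [MeasurableSpace X] {f : X → MarkedConfig G Ξ}
    (h : ∀ U : Set (G × Ξ), MeasurableSet U → Measurable fun x => (count U (f x) : ℝ≥0∞)) :
    Measurable f := by
  rw [measurable_iff_comap_le, MeasurableSpace.comap_le_iff_le_map]
  refine iSup₂_le fun U hU => ?_
  rintro _ ⟨s, -, rfl⟩
  have : (fun x => (count U (f x) : ℝ≥0∞)) ⁻¹' ((fun n : ℕ∞ => (n : ℝ≥0∞)) '' s) =
      f ⁻¹' (count U ⁻¹' s) := by
    ext x
    simp
  rw [MeasurableSpace.map_def, ← this]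
  exact h U hU ((to_countable s).image _).measurableSet

theorem count_smul [Group G] [IsTopologicalGroup G] (U : Set (G × Ξ)) (g : G)
    (ω : MarkedConfig G Ξ) :
    count U (g • ω) = count ((fun p => (g * p.1, p.2)) ⁻¹' U) ω := by
  change ((fun p => (g * p.1, p.2)) '' ω.1 ∩ U).encard =
    (ω.1 ∩ (fun p => (g * p.1, p.2)) ⁻¹' U).encard
  rw [← image_inter_preimage]
  refine InjOn.encard_image fun p _ q _ h => ?_
  simp only [Prod.mk.injEq, mul_right_inj] at h
  exact Prod.ext h.1 h.2

variable [T2Space G] [LocallyCompactSpace G] [SecondCountableTopology G] [BorelSpace G]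

theorem exists_count_ne {f : Ξ → ℕ → Bool} (hf : Function.Injective f) {ω ω' : MarkedConfig G Ξ}
    {p : G × Ξ} (hp : p ∈ ω.1) (hp' : p ∉ ω'.1) :
    ∃ V ∈ TopologicalSpace.countableBasis G, ∃ (i : ℕ) (b : Bool),
      count (V ×ˢ {ξ | f ξ i = b}) ω ≠ count (V ×ˢ {ξ | f ξ i = b}) ω' := by
  obtain ⟨V, hV, hpV, hiso⟩ :=
    exists_countableBasis_isolating (A := Prod.fst '' ω.1 ∪ Prod.fst '' ω'.1)
      (fun K hK => by
        rw [union_inter_distrib_right]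
        exact (ω.2.1 K hK).union (ω'.2.1 K hK)) p.1
  -- The location of `p` may still occur in `ω'` with another mark. There is at most one such mark,
  -- so a single bit of `f` tells it apart.
  obtain ⟨i, hi⟩ : ∃ i, ∀ ξ', (p.1, ξ') ∈ ω'.1 → f ξ' i ≠ f p.2 i := by
    by_cases hex : ∃ ξ', (p.1, ξ') ∈ ω'.1
    · obtain ⟨ξ', hξ'⟩ := hex
      have hne : f ξ' ≠ f p.2 := fun h => hp' (by
        have := hf h
        rw [this] at hξ'
        exact hξ')
      obtain ⟨i, hi⟩ := Function.ne_iff.1 hne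
      refine ⟨i, fun ξ hξ => ?_⟩
      rwa [ω'.2.2 _ _ _ hξ hξ']
    · exact ⟨0, fun ξ' h => absurd ⟨ξ', h⟩ hex⟩
  refine ⟨V, hV, i, f p.2 i, ?_⟩
  have h' : ω'.1 ∩ V ×ˢ {ξ | f ξ i = f p.2 i} = ∅ := eq_empty_of_forall_notMem fun a ha => by
    obtain ⟨a₁, a₂⟩ := a
    obtain rfl : a₁ = p.1 := hiso ⟨Or.inr ⟨_, ha.1, rfl⟩, ha.2.1⟩
    exact hi a₂ ha.1 ha.2.2
  rw [count, count, h', encard_empty]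
  exact (encard_pos.2
    (⟨p, hp, hpV, rfl⟩ : (ω.1 ∩ V ×ˢ {ξ | f ξ i = f p.2 i}).Nonempty)).ne'

theorem countablySeparated [MeasurableSpace.CountablySeparated Ξ] :
    MeasurableSpace.CountablySeparated (MarkedConfig G Ξ) := by
  obtain ⟨f, hfm, hf⟩ := MeasurableSpace.measurable_injection_nat_bool_of_countablySeparated Ξ
  let W : Set G → ℕ → Bool → Set (G × Ξ) := fun V i b => V ×ˢ {ξ | f ξ i = b}
  refine ⟨⟨⋃ V ∈ TopologicalSpace.countableBasis G, ⋃ q : (ℕ × Bool) × ℕ∞,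
    {count (W V q.1.1 q.1.2) ⁻¹' {q.2}}, ?_, ?_, ?_⟩⟩
  · exact (TopologicalSpace.countable_countableBasis G).biUnion fun V _ =>
      countable_iUnion fun n => countable_singleton _
  · intro s hs
    simp only [mem_iUnion, mem_singleton_iff, exists_prop] at hs
    obtain ⟨V, hV, q, rfl⟩ := hs
    have hVm := ((TopologicalSpace.isBasis_countableBasis G).isOpen hV).measurableSet
    have hWm : MeasurableSet (W V q.1.1 q.1.2) := hVm.prod
      (((measurable_pi_apply q.1.1).comp hfm) (measurableSet_singleton q.1.2))
    convert measurable_count hWm (measurableSet_singleton (q.2 : ℝ≥0∞)) using 1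
    ext ω
    simp
  · intro ω _ ω' _ h
    have hc : ∀ V ∈ TopologicalSpace.countableBasis G, ∀ i b,
        count (W V i b) ω = count (W V i b) ω' := by
      intro V hV i b
      have := h (count (W V i b) ⁻¹' {count (W V i b) ω})
        (mem_biUnion hV (mem_iUnion.2 ⟨((i, b), _), rfl⟩))
      exact (this.1 rfl).symm
    apply Subtype.ext
    ext p
    constructor
    · intro hp
      by_contra hp'
      obtain ⟨V, hV, i, b, hne⟩ := exists_count_ne hf hp hp'
      exact hne (hc V hV i b)
    · intro hp
      by_contra hp'
      obtain ⟨V, hV, i, b, hne⟩ := exists_count_ne hf hp hp'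
      exact hne (hc V hV i b).symm

end MarkedConfig

/-! ### Canonical enumeration of finite sets. -/

section Enumeration

variable {S : Type*}

/-- `y` lists the elements of `W` in increasing order of `ι`, followed by the default value `s₀`. -/
def IsSortedEnumeration (ι : S → ℝ) (s₀ : S) (W : Set S) (y : ℕ × (ℕ → S)) : Prop :=
  y.2 '' Iio y.1 = W ∧ (∀ i j, i < j → j < y.1 → ι (y.2 i) < ι (y.2 j)) ∧
    ∀ i, y.1 ≤ i → y.2 i = s₀

theorem exists_isSortedEnumeration {ι : S → ℝ} (hι : Function.Injective ι) (s₀ : S) {W : Set S}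
    (hW : W.Finite) : ∃ y, IsSortedEnumeration ι s₀ W y := by
  let : LinearOrder S := LinearOrder.lift' ι hι
  let t := hW.toFinset
  refine ⟨(t.card, fun i => if h : i < t.card then t.orderEmbOfFin rfl ⟨i, h⟩ else s₀), ?_, ?_, ?_⟩
  · ext a
    have ha : a ∈ W ↔ a ∈ range (t.orderEmbOfFin rfl) := by
      rw [Finset.range_orderEmbOfFin]
      simp [t]
    rw [ha]
    constructor
    · rintro ⟨i, hi, rfl⟩
      have hi' : i < t.card := hi
      exact ⟨⟨i, hi'⟩, by simp only [dif_pos hi']⟩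
    · rintro ⟨i, rfl⟩
      exact ⟨i, i.2, by simp only [dif_pos i.2]⟩
  · intro i j hij hj
    have h := (t.orderEmbOfFin rfl).strictMono (a := ⟨i, hij.trans hj⟩) (b := ⟨j, hj⟩) hij
    simp only [dif_pos hj, dif_pos (hij.trans hj)]
    exact h
  · intro i hi
    exact dif_neg (not_lt.2 hi)

theorem IsSortedEnumeration.unique {ι : S → ℝ} (hι : Function.Injective ι) {s₀ : S} {W : Set S}
    {y z : ℕ × (ℕ → S)} (hy : IsSortedEnumeration ι s₀ W y) (hz : IsSortedEnumeration ι s₀ W z) :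
    y = z := by
  let : LinearOrder S := LinearOrder.lift' ι hι
  have hfin : W.Finite := hy.1 ▸ (finite_Iio y.1).image y.2
  let t := hfin.toFinset
  have key : ∀ w : ℕ × (ℕ → S), IsSortedEnumeration ι s₀ W w →
      ∃ h : t.card = w.1, ∀ i (hi : i < w.1), w.2 i = t.orderEmbOfFin h ⟨i, hi⟩ := by
    intro w hw
    have hmono : StrictMono fun i : Fin w.1 => w.2 i := fun i j hij => hw.2.1 i j hij j.2
    have hcard : t.card = w.1 := by
      have : t = Finset.univ.image fun i : Fin w.1 => w.2 i := by
        ext a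
        rw [Finite.mem_toFinset, ← hw.1]
        constructor
        · rintro ⟨i, hi, rfl⟩
          exact Finset.mem_image.2 ⟨⟨i, hi⟩, Finset.mem_univ _, rfl⟩
        · intro ha
          obtain ⟨i, -, rfl⟩ := Finset.mem_image.1 ha
          exact ⟨i, i.2, rfl⟩
      rw [this, Finset.card_image_of_injective _ hmono.injective, Finset.card_univ,
        Fintype.card_fin]
    refine ⟨hcard, fun i hi => ?_⟩
    have := Finset.orderEmbOfFin_unique hcard (f := fun i : Fin w.1 => w.2 i)
      (fun i => hfin.mem_toFinset.2 (hw.1 ▸ ⟨i, i.2, rfl⟩)) hmono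
    exact congrFun this ⟨i, hi⟩
  obtain ⟨ky, vy⟩ := y
  obtain ⟨kz, vz⟩ := z
  obtain ⟨hy1, hy2⟩ := key _ hy
  obtain ⟨hz1, hz2⟩ := key _ hz
  obtain rfl : ky = kz := hy1.symm.trans hz1
  refine Prod.ext rfl (funext fun i => ?_)
  by_cases hi : i < ky
  · exact (hy2 i hi).trans (hz2 i hi).symm
  · exact (hy.2.2 i (not_lt.1 hi)).trans (hz.2.2 i (not_lt.1 hi)).symm

end Enumeration

/-! ### The standard Borel structure on marked configurations. -/

namespace MarkedConfig

variable {G Ξ : Type*} [TopologicalSpace G]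

/-- The sequences of enumerations of the sets of marked points lying in the layers of a compact
exhaustion of `G`. -/
def layerEnumerations (K : CompactExhaustion G) (ι : G × Ξ → ℝ) (s₀ : G × Ξ) :
    Set (ℕ → ℕ × (ℕ → G × Ξ)) :=
  {y | ∀ n, (∀ i, i < (y n).1 → K.find ((y n).2 i).1 = n) ∧
    (∀ i j, i < j → j < (y n).1 → ι ((y n).2 i) < ι ((y n).2 j)) ∧
    (∀ i j, i < j → j < (y n).1 → ((y n).2 i).1 ≠ ((y n).2 j).1) ∧
    ∀ i, (y n).1 ≤ i → (y n).2 i = s₀}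

variable {K : CompactExhaustion G} {ι : G × Ξ → ℝ} {s₀ : G × Ξ}

theorem eq_of_fst_eq {y : ℕ → ℕ × (ℕ → G × Ξ)} (hy : y ∈ layerEnumerations K ι s₀)
    {n i m j : ℕ} (hi : i < (y n).1) (hj : j < (y m).1)
    (h : ((y n).2 i).1 = ((y m).2 j).1) : n = m ∧ i = j := by
  have hnm : n = m := by rw [← (hy n).1 i hi, ← (hy m).1 j hj, h]
  subst hnm
  refine ⟨rfl, ?_⟩
  rcases lt_trichotomy i j with hij | hij | hij
  · exact absurd h ((hy n).2.2.1 i j hij hj)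
  · exact hij
  · exact absurd h.symm ((hy n).2.2.1 j i hij hi)

/-- The marked configuration listed by a sequence of enumerations. -/
def ofEnumerations (K : CompactExhaustion G) (ι : G × Ξ → ℝ) (s₀ : G × Ξ)
    (y : layerEnumerations K ι s₀) : MarkedConfig G Ξ :=
  ⟨{p | ∃ n i, i < (y.1 n).1 ∧ (y.1 n).2 i = p}, by
    intro C hC
    obtain ⟨m, hm⟩ := K.exists_superset_of_isCompact hC
    refine (((finite_Iic m).biUnion fun n _ =>
      (finite_Iio (y.1 n).1).image fun i => ((y.1 n).2 i).1)).subset ?_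
    rintro _ ⟨⟨_, ⟨n, i, hi, rfl⟩, rfl⟩, hC⟩
    refine mem_biUnion (x := n) ?_ ⟨i, hi, rfl⟩
    rw [mem_Iic, ← (y.2 n).1 i hi]
    exact K.mem_iff_find_le.1 (hm hC), by
    rintro g ξ ξ' ⟨n, i, hi, h⟩ ⟨m, j, hj, h'⟩
    obtain ⟨rfl, rfl⟩ := eq_of_fst_eq y.2 hi hj (by rw [h, h'])
    exact congrArg Prod.snd (h.symm.trans h')⟩

/-- Distinct indices list distinct points, so a count is a countable sum of indicators of Borel
conditions on the lists; measurability of the parametrisation and of the action follows from this.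
-/
theorem count_ofEnumerations (U : Set (G × Ξ)) (y : layerEnumerations K ι s₀) :
    (count U (ofEnumerations K ι s₀ y) : ℝ≥0∞) =
      ∑' q : ℕ × ℕ, {y : layerEnumerations K ι s₀ |
        q.2 < (y.1 q.1).1 ∧ (y.1 q.1).2 q.2 ∈ U}.indicator 1 y := by
  let Q : Set (ℕ × ℕ) := {q | q.2 < (y.1 q.1).1 ∧ (y.1 q.1).2 q.2 ∈ U}
  have himg : (ofEnumerations K ι s₀ y).1 ∩ U = (fun q : ℕ × ℕ => (y.1 q.1).2 q.2) '' Q := by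
    ext p
    constructor
    · rintro ⟨⟨n, i, hi, rfl⟩, hU⟩
      exact ⟨(n, i), ⟨hi, hU⟩, rfl⟩
    · rintro ⟨⟨n, i⟩, ⟨hi, hU⟩, rfl⟩
      exact ⟨⟨n, i, hi, rfl⟩, hU⟩
  have hinj : InjOn (fun q : ℕ × ℕ => (y.1 q.1).2 q.2) Q := by
    rintro ⟨n, i⟩ ⟨hi, -⟩ ⟨m, j⟩ ⟨hj, -⟩ h
    obtain ⟨rfl, rfl⟩ := eq_of_fst_eq y.2 hi hj (congrArg Prod.fst h)
    rfl
  rw [count, himg, hinj.encard_image, ← ENNReal.tsum_set_one, tsum_subtype Q fun _ => (1 : ℝ≥0∞)]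
  rfl

theorem isSortedEnumeration_ofEnumerations (y : layerEnumerations K ι s₀) (n : ℕ) :
    IsSortedEnumeration ι s₀ {p ∈ (ofEnumerations K ι s₀ y).1 | K.find p.1 = n} (y.1 n) := by
  refine ⟨?_, (y.2 n).2.1, (y.2 n).2.2.2⟩
  ext p
  constructor
  · rintro ⟨i, hi, rfl⟩
    exact ⟨⟨n, i, hi, rfl⟩, (y.2 n).1 i hi⟩
  · rintro ⟨⟨m, i, hi, rfl⟩, hp⟩
    rw [(y.2 m).1 i hi] at hp
    subst hp
    exact ⟨i, hi, rfl⟩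

/-- A configuration has finitely many points in each layer, and a finite set has exactly one sorted
list once the tail is fixed to be `s₀`. -/
theorem bijective_ofEnumerations (hι : Function.Injective ι) :
    Function.Bijective (ofEnumerations K ι s₀) := by
  constructor
  · intro y z h
    refine Subtype.ext (funext fun n => ?_)
    have hz := isSortedEnumeration_ofEnumerations z n
    rw [← h] at hz
    exact (isSortedEnumeration_ofEnumerations y n).unique hι hz
  · intro ω
    have hfin : ∀ n, {p ∈ ω.1 | K.find p.1 = n}.Finite := by
      intro n
      refine Finite.of_finite_image (f := Prod.fst) ((ω.2.1 (K n) (K.isCompact n)).subset ?_) ?_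
      · rintro _ ⟨p, ⟨hp, hn⟩, rfl⟩
        exact ⟨⟨p, hp, rfl⟩, K.mem_iff_find_le.2 hn.le⟩
      · rintro ⟨g, ξ⟩ ⟨hp, -⟩ ⟨g', ξ'⟩ ⟨hp', -⟩ (rfl : g = g')
        rw [ω.2.2 g ξ ξ' hp hp']
    choose y hy using fun n => exists_isSortedEnumeration hι s₀ (hfin n)
    have hmem : ∀ n i, i < (y n).1 → (y n).2 i ∈ ω.1 ∧ K.find ((y n).2 i).1 = n := fun n i hi => by
      have : (y n).2 i ∈ {p ∈ ω.1 | K.find p.1 = n} := (hy n).1 ▸ ⟨i, hi, rfl⟩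
      exact this
    refine ⟨⟨y, fun n => ⟨fun i hi => (hmem n i hi).2, (hy n).2.1, fun i j hij hj h => ?_,
      (hy n).2.2⟩⟩, Subtype.ext ?_⟩
    · have hi := (hmem n i (hij.trans hj)).1
      have hj' := (hmem n j hj).1
      have heq : (y n).2 i = (y n).2 j := by
        refine Prod.ext h (ω.2.2 ((y n).2 i).1 _ _ hi ?_)
        rw [h]
        exact hj'
      exact ((hy n).2.1 i j hij hj).ne (congrArg ι heq)
    · ext p
      constructor
      · rintro ⟨n, i, hi, rfl⟩
        exact (hmem n i hi).1
      · intro hp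
        have : p ∈ (y (K.find p.1)).2 '' Iio (y (K.find p.1)).1 := (hy (K.find p.1)).1 ▸ ⟨hp, rfl⟩
        obtain ⟨i, hi, hip⟩ := this
        exact ⟨_, i, hi, hip⟩

theorem measurable_find [T2Space G] [MeasurableSpace G] [BorelSpace G] (K : CompactExhaustion G) :
    Measurable K.find := by
  refine measurable_of_Iic fun n => ?_
  have : K.find ⁻¹' Iic n = K n := by
    ext x
    exact K.mem_iff_find_le.symm
  rw [this]
  exact (K.isCompact n).measurableSet

variable [MeasurableSpace G] [MeasurableSpace Ξ]

theorem measurableSet_layerEnumerations [T2Space G] [SecondCountableTopology G] [BorelSpace G]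
    [MeasurableSingletonClass Ξ] (hι : Measurable ι) :
    MeasurableSet (layerEnumerations K ι s₀) := by
  have hk : ∀ n, Measurable fun y : ℕ → ℕ × (ℕ → G × Ξ) => (y n).1 := fun n =>
    measurable_fst.comp (measurable_pi_apply n)
  have hv : ∀ n i, Measurable fun y : ℕ → ℕ × (ℕ → G × Ξ) => (y n).2 i := fun n i =>
    (measurable_pi_apply i).comp (measurable_snd.comp (measurable_pi_apply n))
  have hlt : ∀ n i, Measurable fun y : ℕ → ℕ × (ℕ → G × Ξ) => i < (y n).1 := fun n i =>
    measurableSet_setOfPred.1 (measurableSet_lt measurable_const (hk n))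
  refine measurableSet_setOfPred.2 (Measurable.forall fun n => ?_)
  refine (Measurable.forall fun i => ?_).and ((Measurable.forall fun i => Measurable.forall
    fun j => ?_).and ((Measurable.forall fun i => Measurable.forall fun j => ?_).and
    (Measurable.forall fun i => ?_)))
  · exact (hlt n i).imp (((measurable_find K).comp (measurable_fst.comp (hv n i))).eq_const n)
  · exact measurable_const.imp ((hlt n j).imp (measurableSet_setOfPred.1
      (measurableSet_lt (hι.comp (hv n i)) (hι.comp (hv n j)))))
  · exact measurable_const.imp ((hlt n j).imp (measurableSet_setOfPred.1 (measurableSet_eq_fun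
      (measurable_fst.comp (hv n i)) (measurable_fst.comp (hv n j)))).not)
  · exact (measurableSet_setOfPred.1 (measurableSet_le (hk n) measurable_const)).imp
      ((hv n i).eq_const s₀)

theorem measurableSet_setOf_enumeration_mem {A : Type*} [MeasurableSpace A]
    {U : Set (A × G × Ξ)} (hU : MeasurableSet U) (q : ℕ × ℕ) :
    MeasurableSet {b : A × layerEnumerations K ι s₀ |
      q.2 < (b.2.1 q.1).1 ∧ (b.1, (b.2.1 q.1).2 q.2) ∈ U} := by
  have hy : Measurable fun b : A × layerEnumerations K ι s₀ => b.2.1 q.1 :=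
    (measurable_pi_apply q.1).comp (measurable_subtype_coe.comp measurable_snd)
  exact (measurableSet_lt measurable_const (measurable_fst.comp hy)).inter
    ((measurable_fst.prodMk ((measurable_pi_apply q.2).comp (measurable_snd.comp hy))) hU)

theorem measurable_ofEnumerations : Measurable (ofEnumerations K ι s₀) := by
  refine measurable_of_count fun U hU => ?_
  simp_rw [count_ofEnumerations]
  refine Measurable.tsum fun q => measurable_one.indicator ?_
  exact measurable_prodMk_left (x := ())
    (measurableSet_setOf_enumeration_mem (A := Unit) (measurable_snd hU) q)

variable [T2Space G] [LocallyCompactSpace G] [SecondCountableTopology G] [BorelSpace G]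
  [Group G] [IsTopologicalGroup G] [StandardBorelSpace Ξ]

/-- The space of marked configurations is a standard Borel space on which `G` acts measurably. -/
theorem standardBorelSpace_and_measurableSMul₂ :
    StandardBorelSpace (MarkedConfig G Ξ) ∧ MeasurableSMul₂ G (MarkedConfig G Ξ) := by
  -- Without marks there is no filler `s₀`, but then the empty configuration is the only one.
  rcases isEmpty_or_nonempty (G × Ξ) with he | ⟨⟨s₀⟩⟩
  · have : Subsingleton (MarkedConfig G Ξ) :=
      ⟨fun ω ω' => Subtype.ext (by rw [eq_empty_of_isEmpty ω.1, eq_empty_of_isEmpty ω'.1])⟩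
    exact ⟨inferInstance, ⟨measurable_of_subsingleton_codomain _⟩⟩
  have := polishSpace_of_locallyCompact_group G
  have := countablySeparated (G := G) (Ξ := Ξ)
  obtain ⟨ι, hι⟩ := exists_measurableEmbedding_real (G × Ξ)
  let K : CompactExhaustion G := default
  have : StandardBorelSpace (layerEnumerations K ι s₀) :=
    (measurableSet_layerEnumerations hι.measurable).standardBorel
  have hbij := bijective_ofEnumerations (K := K) (s₀ := s₀) hι.injective
  have hemb : MeasurableEmbedding (ofEnumerations K ι s₀) :=
    measurable_ofEnumerations.measurableEmbedding hbij.1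
  let e : layerEnumerations K ι s₀ ≃ᵐ MarkedConfig G Ξ :=
    { Equiv.ofBijective _ hbij with
      measurable_toFun := hemb.measurable
      measurable_invFun := fun s hs => by
        rw [← Equiv.image_eq_preimage_symm]
        exact hemb.measurableSet_image.2 hs }
  refine ⟨e.standardBorelSpace, ⟨?_⟩⟩
  -- Joint measurability is checked on the lists, where counts are explicit sums, and carried back
  -- along `e`.
  have hsm : Measurable fun b : G × layerEnumerations K ι s₀ => b.1 • ofEnumerations K ι s₀ b.2 := by
    refine measurable_of_count fun U hU => ?_
    simp_rw [count_smul, count_ofEnumerations]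
    refine Measurable.tsum fun q => ?_
    have hU' : MeasurableSet {a : G × G × Ξ | (a.1 * a.2.1, a.2.2) ∈ U} :=
      ((measurable_fst.mul (measurable_fst.comp measurable_snd)).prodMk
        (measurable_snd.comp measurable_snd)) hU
    exact measurable_one.indicator (measurableSet_setOf_enumeration_mem hU' q)
  have := hsm.comp (measurable_fst.prodMk (e.symm.measurable.comp measurable_snd))
  have heq : (fun b : G × MarkedConfig G Ξ => b.1 • b.2) =
      fun b => b.1 • ofEnumerations K ι s₀ (e.symm b.2) :=
    funext fun b => congrArg (b.1 • ·) (e.apply_symm_apply b.2).symm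
  change Measurable fun b : G × MarkedConfig G Ξ => b.1 • b.2
  rw [heq]
  exact this

end MarkedConfig

theorem mainTheorem11 {G : Type*} [Group G] [TopologicalSpace G] [IsTopologicalGroup G]
    [T2Space G] [LocallyCompactSpace G] [SecondCountableTopology G]
    [MeasurableSpace G] [BorelSpace G] (hG : ¬ DiscreteTopology G)
    (haar : Measure G) [haar.IsHaarMeasure] :
    (∀ (X : Type*) [MeasurableSpace X] [StandardBorelSpace X] [MulAction G X]
        [MeasurableSMul₂ G X] (μ : Measure X) [IsProbabilityMeasure μ]
        [SMulInvariantMeasure G X μ],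
      EssentiallyFree G μ →
        ∃ ν : Measure (Config G), IsPointProcess ν ∧
          (∃ c : ℝ≥0∞, c < ∞ ∧ HasIntensity haar ν c) ∧ AbstractlyIsomorphic G μ ν) ∧
    (∀ (Ξ : Type*) [MeasurableSpace Ξ] [StandardBorelSpace Ξ] (μ : Measure (MarkedConfig G Ξ)),
      IsMarkedPointProcess μ → EssentiallyFree G μ →
        ∃ ν : Measure (Config G), IsPointProcess ν ∧ AbstractlyIsomorphic G μ ν) := by
  refine ⟨fun X _ _ _ _ μ _ _ hμ => exists_pointProcess_abstractlyIsomorphic hG haar X μ hμ,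
    fun Ξ _ _ μ hμ hfree => ?_⟩
  obtain ⟨_, _⟩ := hμ
  obtain ⟨_, _⟩ := MarkedConfig.standardBorelSpace_and_measurableSMul₂ (G := G) (Ξ := Ξ)
  obtain ⟨ν, hν, -, hiso⟩ :=
    exists_pointProcess_abstractlyIsomorphic hG haar (MarkedConfig G Ξ) μ hfree
  exact ⟨ν, hν, hiso⟩
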